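/- **Setting.** All manifolds, bundles and maps are smooth ($C^\infty$), $M$ is a finite-dimensional, Hausdorff, $\sigma$-compact manifold without boundary. A *special affine bundle* $\mathbf A=(A,v_{\mathbf A})$ over $M$ is a finite-rank affine bundle $A\to M$ whose model vector bundle $\mathsf V(A)$ carries a nowhere-vanishing section $v_{\mathbf A}$. Put $\underline{\mathbf A}=A/\langle v_{\mathbf A}\rangle$ (quotient by the orbits $a_x+\mathbb R v_{\mathbf A}(x)$); $\mathsf{AV}(\mathbf A)$ is the one-dimensional affine bundle $A\to\underline{\mathbf A}$ with distinguished section $-v_{\mathbf A}$, so that the difference of two sections is the function $f=\tau-\sigma$ with $\tau=\sigma-f\,v_{\mathbf A}$. The *special affine dual* $\mathbf A^\#$ has as fibre over $x$ the affine functions $\varphi$ on $A_x$ with $\varphi_{\mathsf v}(v_{\mathbf A}(x))=1$, where $\varphi_{\mathsf v}$ is the linear part of $\varphi$; its distinguished section is the constant function $1$. Local affine coordinates $(x^a,y^i,y^m)$ on $\mathbf A$, $1\le i\le m-1$, in which $v_{\mathbf A}=-\partial_{y^m}$, give coordinates $(x^a,y^i)$ on $\underline{\mathbf A}$ and dual coordinates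 $(x^a,\xi_0,\xi_i)$ on $\mathbf A^\#$, in which the pairing is $\sum_i y^i\xi_i-y^m-\xi_0$, and $(x^a,\xi_i)$ on $\underline{\mathbf A^\#}$. The *phase bundle* $\mathsf P\mathbf A\to\underline{\mathbf A}$ consists of the classes $\boldsymbol d\sigma(a)$ of pairs $(a,\sigma)$, $a\in\underline{\mathbf A}$, $\sigma$ a section of $\mathsf{AV}(\mathbf A)$, where $(a,\sigma)\sim(a,\sigma')$ if $\mathrm d(\sigma'-\sigma)(a)=0$. If $\sigma$ is given by $y^m=\sigma(x,y)$, then $\boldsymbol d\sigma(a)$ has the coordinates $(x,y,p,\pi)$ with $p_b=\partial\sigma/\partial x^b$, $\pi_j=\partial\sigma/\partial y^j$ at $a=(x,y)$. With the projections $(x,y,p,\pi)\mapsto(x,y)$ onto $\underline{\mathbf A}$ and $(x,y,p,\pi)\mapsto(x,\pi)$ onto $\underline{\mathbf A^\#}$, $\mathsf P\mathbf A$ is a double affine bundle, and $\mathcal R(x,y,p,\pi)=(x,\pi,-p,y)$ is a canonical isomorphism $\mathsf P\mathbf A\to\mathsf P\mathbf A^\#$. A *special affgebroid* on $\mathbf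 A$ is a morphism of double affine bundles $\mathcal E:\mathsf P\mathbf A\to\mathsf T\underline{\mathbf A^\#}$ covering the identity on $\underline{\mathbf A^\#}$ and on $M$; i.e. in such coordinates $$\mathcal E(x,y,p,\pi)=(x,\pi,\dot x,\dot\xi),\qquad \dot x=\Phi_1(x,y),\quad \dot\xi=\Phi_3(x,y,\pi,p),$$ with $\Phi_1,\Phi_3$ smooth, $\Phi_1$ affine in $y$, and $\Phi_3$ affine in $(\pi,p)$ for fixed $(x,y)$ and affine in $(y,p)$ for fixed $(x,\pi)$. It defines the bracket of a section $\sigma$ of $\mathsf{AV}(\mathbf A^\#)$ and a function $f$ on $\underline{\mathbf A^\#}$, $$\{\sigma,f\}_{\mathcal E}(\varphi)=\mathrm df\big(\mathcal E(\mathcal R^{-1}(\boldsymbol d\sigma(\varphi)))\big),\qquad \varphi\in\underline{\mathbf A^\#}.$$ The Hamiltonian vector field of a section $\mathcal H$ of $\mathsf{AV}(\mathbf A^\#)$ is the smooth vector field on $\underline{\mathbf A^\#}$ corresponding to the derivation $f\mapsto\{\mathcal H,f\}_{\mathcal E}$. Let $\mathcal L$ be a section of $\mathsf{AV}(\mathbf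 A)$ (a Lagrangian section). Its *dynamics* is the set $\mathcal D=\mathcal E(\boldsymbol d\mathcal L(\underline{\mathbf A}))\subset\mathsf T\underline{\mathbf A^\#}$, and its *Legendre map* $\mathcal L_{eg}:\underline{\mathbf A}\to\underline{\mathbf A^\#}$ is the composition of $\boldsymbol d\mathcal L:\underline{\mathbf A}\to\mathsf P\mathbf A$ with the projection $\mathsf P\mathbf A\to\underline{\mathbf A^\#}$. A section $\mathcal H$ of $\mathsf{AV}(\mathbf A^\#)$ is a *Hamiltonian associated with* $\mathcal L$ if $\mathcal D$ is the image of the Hamiltonian vector field of $\mathcal H$. For $a\in\underline{\mathbf A}_x$ let $W_a\subset A_x$ be the affine subspace through $\mathcal L(a)$ that is tangent at $\mathcal L(a)$ to the submanifold $\mathcal L(\underline{\mathbf A}_x)$ of $A_x$. **Theorem.** Let $\mathcal E$ be a special affgebroid on a special affine bundle $\mathbf A$ over $M$, and let $\mathcal L$ be a section of $\mathsf{AV}(\mathbf A)$ whose Legendre map $\mathcal L_{eg}:\underline{\mathbf A}\to\underline{\mathbf A^\#}$ is a diffeomorphism. Then: 1. for every $x\in M$ and $a\in\underline{\mathbf A}_x$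 there is exactly one $\widehat{\mathcal L}(a)\in\mathbf A^\#_x$ that vanishes on $W_a$; 2. $\mathcal H=\widehat{\mathcal L}\circ\mathcal L_{eg}^{-1}$ is a (smooth) section of $\mathsf{AV}(\mathbf A^\#)$; 3. $\mathcal H$ is a Hamiltonian associated with $\mathcal L$: the Hamiltonian vector field of $\mathcal H$ exists as a smooth vector field on $\underline{\mathbf A^\#}$, and its image is $\mathcal D=\mathcal E(\boldsymbol d\mathcal L(\underline{\mathbf A}))$; 4. in coordinates as above, if $\mathcal L$ is given by $y^m=\mathcal L(x,y)$ and $\mathcal H$ by $\xi_0=\mathcal H(x,\xi)$, then $\mathcal L_{eg}(x,y)=(x,\partial\mathcal L/\partial y)$ and $$\mathcal H\Big(x,\frac{\partial\mathcal L}{\partial y}(x,y)\Big)=\sum_{i=1}^{m-1}y^i\frac{\partial\mathcal L}{\partial y^i}(x,y)-\mathcal L(x,y).$$ -/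

import Mathlib

set_option linter.unusedSectionVars false
set_option linter.checkUnivs false

open Set Bundle
open scoped Manifold ContDiff

noncomputable section

/-- A special vector space: a real vector space with a distinguished non-zero vector. -/
class SpecialVectorSpace (V : Type*) [AddCommGroup V] [Module ℝ V] where
  vec : V
  vec_ne_zero : vec ≠ 0

namespace SpecialAffine

/-! ### Special affine spaces -/

section Space

variable {V A : Type*} [AddCommGroup V] [Module ℝ V] [AddTorsor V A] [SpecialVectorSpace V]

variable (V) in
/-- The line spanned by the distinguished vector. -/
def line : Submodule ℝ V := Submodule.span ℝ {SpecialVectorSpace.vec}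

variable (V A) in
/-- Two points are in the same orbit of the translations by multiples of the distinguished
vector. -/
def orbitSetoid : Setoid A where
  r a b := a -ᵥ b ∈ line V
  iseqv :=
    { refl := fun a => by simp
      symm := fun {a b} h => by
        rw [← neg_vsub_eq_vsub_rev]; exact neg_mem h
      trans := fun {a b c} h h' => by
        rw [← vsub_add_vsub_cancel a b c]; exact add_mem h h' }

variable (V A) in
/-- The quotient of a special affine space by the orbits of its distinguished vector. -/
def Red : Type _ := Quotient (orbitSetoid V A)

/-- The class of a point in the quotient. -/
def Red.mk (a : A) : Red V A := Quotient.mk (orbitSetoid V A) a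

theorem Red.mk_eq_mk {a b : A} : (Red.mk a : Red V A) = Red.mk b ↔ a -ᵥ b ∈ line V :=
  Quotient.eq (r := orbitSetoid V A)

theorem Red.ind {p : Red V A → Prop} (h : ∀ a : A, p (Red.mk a)) (α : Red V A) : p α :=
  Quotient.ind h α

/-- The quotient of a special affine space modelled on `V` is an affine space modelled on the
quotient vector space. -/
instance : AddTorsor (V ⧸ line V) (Red V A) where
  vadd w α := Quotient.liftOn₂' w α (fun w a => Red.mk (w +ᵥ a)) (by
    intro w a w' a' hw ha
    refine Red.mk_eq_mk.2 ?_
    have hw' : w - w' ∈ line V := (Submodule.quotientRel_def _).1 hw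
    have ha' : a -ᵥ a' ∈ line V := ha
    have : (w +ᵥ a) -ᵥ (w' +ᵥ a') = (w - w') + (a -ᵥ a') := by
      rw [vadd_vsub_assoc, vsub_vadd_eq_vsub_sub]; abel
    rw [this]; exact add_mem hw' ha')
  zero_vadd α := by
    induction α using Red.ind with | h a => exact congrArg Red.mk (zero_vadd V a)
  add_vadd w w' α := by
    induction α using Red.ind with | h a =>
    induction w using Submodule.Quotient.induction_on with | H w =>
    induction w' using Submodule.Quotient.induction_on with | H w' =>
    exact congrArg Red.mk (add_vadd w w' a)
  vsub α β := Quotient.liftOn₂' α β (fun a b => (line V).mkQ (a -ᵥ b)) (by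
    intro a b a' b' ha hb
    refine (Submodule.Quotient.eq _).2 ?_
    have ha' : a -ᵥ a' ∈ line V := ha
    have hb' : b -ᵥ b' ∈ line V := hb
    have : (a -ᵥ b) - (a' -ᵥ b') = (a -ᵥ a') - (b -ᵥ b') := by
      rw [vsub_sub_vsub_comm]
    rw [this]; exact sub_mem ha' hb')
  nonempty := (AddTorsor.nonempty (G := V) (P := A)).map Red.mk
  vsub_vadd' α β := by
    induction α using Red.ind with | h a =>
    induction β using Red.ind with | h b => exact congrArg Red.mk (vsub_vadd a b)
  vadd_vsub' w α := by
    induction α using Red.ind with | h a =>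
    induction w using Submodule.Quotient.induction_on with | H w =>
    exact congrArg (line V).mkQ (vadd_vsub w a)

theorem Red.mk_vadd (w : V) (a : A) :
    (Submodule.Quotient.mk w : V ⧸ line V) +ᵥ (Red.mk a : Red V A) = Red.mk (w +ᵥ a) := rfl

variable (V A) in
/-- The special affine dual: affine functions whose linear part maps the distinguished vector
to `1`. -/
def SDual : Type _ := {f : A →ᵃ[ℝ] ℝ // f.linear (SpecialVectorSpace.vec : V) = 1}

variable (V A) in
/-- The model vector space of the special affine dual: affine functions whose linear part
vanishes on the distinguished vector. -/
def SDualDir : Submodule ℝ (A →ᵃ[ℝ] ℝ) where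
  carrier := {g | g.linear (SpecialVectorSpace.vec : V) = 0}
  add_mem' {f g} hf hg := by
    simp only [mem_ofPred_eq, AffineMap.add_linear, LinearMap.add_apply] at *; rw [hf, hg, add_zero]
  zero_mem' := by simp
  smul_mem' c f hf := by
    simp only [mem_ofPred_eq, AffineMap.smul_linear, LinearMap.smul_apply] at *; rw [hf, smul_zero]

instance : AddTorsor (SDualDir V A) (SDual V A) where
  vadd g f := ⟨(g : A →ᵃ[ℝ] ℝ) + f.1, by
    have : g.1.linear (SpecialVectorSpace.vec : V) = 0 := g.2
    simp [f.2, this]⟩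
  zero_vadd f := Subtype.ext (zero_add f.1)
  add_vadd g g' f := Subtype.ext (add_assoc g.1 g'.1 f.1)
  vsub f f' := ⟨f.1 - f'.1, by
    change (f.1 - f'.1).linear _ = 0
    simp [f.2, f'.2]⟩
  nonempty := by
    obtain ⟨φ, hφ⟩ := Module.Projective.exists_dual_eq_one ℝ
      (SpecialVectorSpace.vec_ne_zero (V := V))
    obtain ⟨a⟩ := AddTorsor.nonempty (G := V) (P := A)
    exact ⟨⟨φ.toAffineMap.comp (AffineEquiv.vaddConst ℝ a).symm.toAffineMap, by simp [hφ]⟩⟩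
  vsub_vadd' f f' := Subtype.ext (sub_add_cancel f.1 f'.1)
  vadd_vsub' g f := Subtype.ext (add_sub_cancel_right g.1 f.1)

/-- The model space of the special affine dual is special, the distinguished vector being the
constant function `1`. -/
instance : SpecialVectorSpace (SDualDir V A) where
  vec := ⟨AffineMap.const ℝ A 1, by change (AffineMap.const ℝ A (1 : ℝ)).linear _ = 0; simp⟩
  vec_ne_zero h := by
    obtain ⟨a⟩ := AddTorsor.nonempty (G := V) (P := A)
    have := congrArg (fun g : SDualDir V A => g.1 a) h
    simp at this


/-! ### Coordinates on special affine spaces -/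

variable {F : Type*} [NormedAddCommGroup F] [NormedSpace ℝ F]

/-- Coordinates `(y, s)` on a special affine space, in which the distinguished vector is `(0, 1)`,
induce coordinates `y` on the quotient. -/
def redCoord (e : A ≃ᵃ[ℝ] F × ℝ) (he : e.linear (SpecialVectorSpace.vec : V) = (0, 1)) :
    Red V A ≃ᵃ[ℝ] F where
  toFun α := Quotient.liftOn α (fun a => (e a).1) (by
    intro a b h
    obtain ⟨c, hc⟩ := Submodule.mem_span_singleton.1 (show a -ᵥ b ∈ line V from h)
    have h2 : e.linear (a -ᵥ b) = e a - e b := e.toAffineMap.linearMap_vsub a b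
    rw [← hc, map_smul, he] at h2
    have h3 := congrArg Prod.fst h2
    exact sub_eq_zero.1 (by simpa using h3.symm))
  invFun y := Red.mk (e.symm (y, 0))
  left_inv α := by
    induction α using Red.ind with | h a =>
    refine Red.mk_eq_mk.2 (Submodule.mem_span_singleton.2 ⟨-(e a).2, ?_⟩)
    apply e.linear.injective
    have h2 : e.linear (e.symm ((e a).1, 0) -ᵥ a) = e (e.symm ((e a).1, 0)) - e a :=
      e.toAffineMap.linearMap_vsub _ _
    refine Eq.trans ?_ h2.symm
    rw [map_smul]
    refine (congrArg _ he).trans ?_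
    ext <;> simp
  right_inv y := by
    change (e (e.symm (y, 0))).1 = y
    simp
  linear := 
    { toFun := fun w => (line V).liftQ (LinearMap.fst ℝ F ℝ ∘ₗ (e.linear : V →ₗ[ℝ] F × ℝ)) (by
        rw [line, Submodule.span_singleton_le_iff_mem]
        simp [he]) w
      map_add' := fun w w' => map_add _ w w'
      map_smul' := fun c w => map_smul _ c w
      invFun := fun y => Submodule.Quotient.mk (e.linear.symm (y, 0))
      left_inv := fun w => by
        induction w using Submodule.Quotient.induction_on with | H w =>
        refine (Submodule.Quotient.eq _).2 (Submodule.mem_span_singleton.2 ⟨-(e.linear w).2, ?_⟩)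
        apply e.linear.injective
        have h : e.linear (e.linear.symm ((e.linear w).1, 0) - w) =
            ((e.linear w).1, 0) - e.linear w := by simp
        refine Eq.trans ?_ h.symm
        rw [map_smul]
        refine (congrArg _ he).trans ?_
        ext <;> simp
      right_inv := fun y => by
        change (e.linear (e.linear.symm (y, 0))).1 = y
        simp }
  map_vadd' α w := by
    induction α using Red.ind with | h a =>
    induction w using Submodule.Quotient.induction_on with | H w =>
    change (e (w +ᵥ a)).1 = (e.linear w).1 + (e a).1
    rw [e.map_vadd]; rfl

theorem redCoord_mk (e : A ≃ᵃ[ℝ] F × ℝ) (he) (a : A) :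
    redCoord e he (Red.mk a : Red V A) = (e a).1 := rfl

theorem redCoord_symm (e : A ≃ᵃ[ℝ] F × ℝ) (he) (y : F) :
    (redCoord e he).symm y = (Red.mk (e.symm (y, 0)) : Red V A) := rfl

/-- The affine function `(y, s) ↦ ξ y + s + c` in the coordinates `(y, s)`. -/
def dualFun (e : A ≃ᵃ[ℝ] F × ℝ) (ξ : F →L[ℝ] ℝ) (c : ℝ) : A →ᵃ[ℝ] ℝ :=
  (((ξ : F →ₗ[ℝ] ℝ).comp (LinearMap.fst ℝ F ℝ) + LinearMap.snd ℝ F ℝ).toAffineMap +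
    AffineMap.const ℝ (F × ℝ) c).comp e.toAffineMap

theorem dualFun_apply (e : A ≃ᵃ[ℝ] F × ℝ) (ξ : F →L[ℝ] ℝ) (c : ℝ) (a : A) :
    dualFun e ξ c a = ξ (e a).1 + (e a).2 + c := by
  simp [dualFun]

theorem dual_aux (e : A ≃ᵃ[ℝ] F × ℝ) (he : e.linear (SpecialVectorSpace.vec : V) = (0, 1))
    (f : A →ᵃ[ℝ] ℝ) (a : A) : f a = f.linear (e.linear.symm ((e a).1, 0)) +
      (e a).2 * f.linear (SpecialVectorSpace.vec : V) + f (e.symm (0, 0)) := by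
  have h2 : e.linear (a -ᵥ e.symm (0, 0)) = e a - e (e.symm (0, 0)) :=
    e.toAffineMap.linearMap_vsub _ _
  have h3 : a -ᵥ e.symm (0, 0) = e.linear.symm ((e a).1, 0) +
      (e a).2 • (SpecialVectorSpace.vec : V) := by
    apply e.linear.injective
    rw [h2, map_add, map_smul, he, e.linear.apply_symm_apply, e.apply_symm_apply]
    ext <;> simp
  have h4 := f.linearMap_vsub a (e.symm (0, 0))
  rw [h3, map_add, map_smul, smul_eq_mul] at h4
  rw [h4]
  simp

/-- Coordinates `(y, s)` on a special affine space, in which the distinguished vector is `(0, 1)`,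
induce coordinates `(ξ, c)` on the special affine dual, in which the pairing is
`ξ y + s + c` and the distinguished vector is `(0, 1)`. -/
def dualCoord [FiniteDimensional ℝ F] (e : A ≃ᵃ[ℝ] F × ℝ) (he : e.linear (SpecialVectorSpace.vec : V) = (0, 1)) :
    SDual V A ≃ᵃ[ℝ] (F →L[ℝ] ℝ) × ℝ where
  toFun f := (LinearMap.toContinuousLinearMap
    (f.1.linear ∘ₗ (e.linear.symm : F × ℝ →ₗ[ℝ] V) ∘ₗ LinearMap.inl ℝ F ℝ), f.1 (e.symm (0, 0)))
  invFun p := ⟨dualFun e p.1 p.2, by simp [dualFun, he]⟩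
  left_inv f := by
    refine Subtype.ext (AffineMap.ext fun a => ?_)
    have h := dual_aux e he f.1 a
    rw [f.2] at h
    change dualFun e _ _ a = f.1 a
    rw [dualFun_apply, h]
    simp
  right_inv p := by
    ext <;> simp [dualFun]
  linear :=
    { toFun := fun g => (LinearMap.toContinuousLinearMap
        (g.1.linear ∘ₗ (e.linear.symm : F × ℝ →ₗ[ℝ] V) ∘ₗ LinearMap.inl ℝ F ℝ),
          g.1 (e.symm (0, 0)))
      map_add' := fun g g' => by ext <;> simp
      map_smul' := fun c g => by ext <;> simp
      invFun := fun p => ⟨dualFun e p.1 p.2 - dualFun e 0 0, by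
        change (dualFun e p.1 p.2 - dualFun e 0 0).linear _ = 0
        simp [dualFun, he]⟩
      left_inv := fun g => by
        refine Subtype.ext (AffineMap.ext fun a => ?_)
        have h := dual_aux e he g.1 a
        rw [show g.1.linear (SpecialVectorSpace.vec : V) = 0 from g.2] at h
        change dualFun e _ _ a - dualFun e 0 0 a = g.1 a
        rw [dualFun_apply, dualFun_apply, h]
        simp
        ring
      right_inv := fun p => by
        ext <;> simp [dualFun] }
  map_vadd' f g := by
    ext
    · change (g.1 + f.1).linear _ = g.1.linear _ + f.1.linear _
      simp
    · rfl

end Space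

/-! ### Affine bundles -/

section Bundle

/-- A smooth affine bundle over the manifold `M` (modelled on `E`) with fibres `Fib x`, modelled on
the vector spaces `Dir x`, and with model fibre `F`, given by an atlas of local trivializations that
are affine on the fibres and have smooth transition maps.  (The values of `triv i x` for `x`
outside of `baseSet i` are irrelevant.) -/
structure AffineBundle (E : Type*) [NormedAddCommGroup E] [NormedSpace ℝ E]
    (M : Type*) [TopologicalSpace M] [ChartedSpace E M]
    (F : Type*) [NormedAddCommGroup F] [NormedSpace ℝ F] where
  Dir : M → Type*
  Fib : M → Type*
  [addCommGroup : ∀ x, AddCommGroup (Dir x)]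
  [module : ∀ x, Module ℝ (Dir x)]
  [addTorsor : ∀ x, AddTorsor (Dir x) (Fib x)]
  ι : Type*
  baseSet : ι → Set M
  isOpen_baseSet : ∀ i, IsOpen (baseSet i)
  indexAt : M → ι
  mem_baseSet_at : ∀ x, x ∈ baseSet (indexAt x)
  triv : ∀ (_ : ι) (x : M), Fib x ≃ᵃ[ℝ] F
  contMDiffOn_triv : ∀ i j, ContMDiffOn (𝓘(ℝ, E).prod 𝓘(ℝ, F)) 𝓘(ℝ, F) ∞
    (fun p : M × F => triv j p.1 ((triv i p.1).symm p.2)) ((baseSet i ∩ baseSet j) ×ˢ univ)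

attribute [instance] AffineBundle.addCommGroup AffineBundle.module AffineBundle.addTorsor

variable {E : Type*} [NormedAddCommGroup E] [NormedSpace ℝ E]
  {M : Type*} [TopologicalSpace M] [ChartedSpace E M]
  {F : Type*} [NormedAddCommGroup F] [NormedSpace ℝ F]

namespace AffineBundle

variable (𝔹 : AffineBundle E M F)

/-- The total space of an affine bundle. -/
abbrev Total : Type _ := TotalSpace F 𝔹.Fib

/-- The fibres carry the topology that makes the affine coordinates homeomorphisms. -/
instance (x : M) : TopologicalSpace (𝔹.Fib x) :=
  TopologicalSpace.induced (𝔹.triv (𝔹.indexAt x) x) inferInstance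

/-- A local trivialization, as a bijection onto `baseSet i × F`. -/
def pretriv (i : 𝔹.ι) : Pretrivialization F (π F 𝔹.Fib) where
  toFun a := (a.1, 𝔹.triv i a.1 a.2)
  invFun p := ⟨p.1, (𝔹.triv i p.1).symm p.2⟩
  source := π F 𝔹.Fib ⁻¹' 𝔹.baseSet i
  target := 𝔹.baseSet i ×ˢ univ
  map_source' a ha := ⟨ha, mem_univ _⟩
  map_target' p hp := hp.1
  left_inv' a _ := by simp
  right_inv' p _ := by simp
  open_target := (𝔹.isOpen_baseSet i).prod isOpen_univ
  baseSet := 𝔹.baseSet i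
  open_baseSet := 𝔹.isOpen_baseSet i
  source_eq := rfl
  target_eq := rfl
  proj_toFun _ _ := rfl

/-- The trivializations of an affine bundle define a topological fibre bundle. -/
def prebundle : FiberPrebundle F 𝔹.Fib where
  pretrivializationAtlas := range 𝔹.pretriv
  pretrivializationAt x := 𝔹.pretriv (𝔹.indexAt x)
  mem_base_pretrivializationAt := 𝔹.mem_baseSet_at
  pretrivialization_mem_atlas x := mem_range_self _
  continuous_trivChange := by
    rintro _ ⟨j, rfl⟩ _ ⟨i, rfl⟩
    have h := (𝔹.contMDiffOn_triv i j).continuousOn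
    have h2 : ContinuousOn (fun p : M × F => (p.1, 𝔹.triv j p.1 ((𝔹.triv i p.1).symm p.2)))
        ((𝔹.baseSet i ∩ 𝔹.baseSet j) ×ˢ univ) := continuousOn_fst.prodMk h
    exact h2.mono fun p hp => ⟨⟨hp.1.1, hp.2⟩, mem_univ _⟩
  totalSpaceMk_isInducing x := by
    have h : Topology.IsInducing (𝔹.triv (𝔹.indexAt x) x) := ⟨rfl⟩
    exact (Topology.isInducing_const_prod.2 h)

instance : TopologicalSpace 𝔹.Total := 𝔹.prebundle.totalSpaceTopology

instance : FiberBundle F 𝔹.Fib := 𝔹.prebundle.toFiberBundle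

theorem contMDiffOn_trivChange (i j : 𝔹.ι) :
    ContMDiffOn (𝓘(ℝ, E).prod 𝓘(ℝ, F)) (𝓘(ℝ, E).prod 𝓘(ℝ, F)) ∞
    (fun p : M × F => (p.1, 𝔹.triv j p.1 ((𝔹.triv i p.1).symm p.2)))
      ((𝔹.baseSet i ∩ 𝔹.baseSet j) ×ˢ univ) :=
  contMDiffOn_fst.prodMk (𝔹.contMDiffOn_triv i j)

/-- The groupoid of smooth local diffeomorphisms of `M × F`. -/
def smoothGroupoid (E : Type*) [NormedAddCommGroup E] [NormedSpace ℝ E]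
    (M : Type*) [TopologicalSpace M] [ChartedSpace E M]
    (F : Type*) [NormedAddCommGroup F] [NormedSpace ℝ F] : StructureGroupoid (M × F) :=
  Pregroupoid.groupoid
    { property := fun f s => ContMDiffOn (𝓘(ℝ, E).prod 𝓘(ℝ, F)) (𝓘(ℝ, E).prod 𝓘(ℝ, F)) ∞ f s
      comp := fun hf hg _ _ _ => hg.comp' hf
      id_mem := contMDiffOn_id
      locality := fun _ h => by
        intro x hx
        obtain ⟨v, hv, hxv, h⟩ := h x hx
        exact (h x ⟨hx, hxv⟩).mono_of_mem_nhdsWithin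
          (Filter.inter_mem self_mem_nhdsWithin (mem_nhdsWithin_of_mem_nhds (hv.mem_nhds hxv)))
      congr := fun _ h hf => hf.congr h }

/-- The total space of a smooth affine bundle is a smooth manifold. -/
instance [IsManifold 𝓘(ℝ, E) ∞ M] : IsManifold (𝓘(ℝ, E).prod 𝓘(ℝ, F)) ∞ 𝔹.Total := by
  have : HasGroupoid 𝔹.Total (smoothGroupoid E M F) := by
    constructor
    rintro _ _ ⟨_, ⟨_, ⟨i, rfl⟩, rfl⟩, rfl⟩ ⟨_, ⟨_, ⟨j, rfl⟩, rfl⟩, rfl⟩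
    refine mem_groupoid_of_pregroupoid.2 ⟨?_, ?_⟩
    · refine (𝔹.contMDiffOn_trivChange i j).mono fun p hp => ?_
      exact ⟨⟨hp.1.1, hp.2⟩, mem_univ _⟩
    · refine (𝔹.contMDiffOn_trivChange j i).mono fun p hp => ?_
      exact ⟨⟨hp.1.1, hp.2⟩, mem_univ _⟩
  refine { StructureGroupoid.HasGroupoid.comp (smoothGroupoid E M F) ?_ with }
  intro e he
  rw [isLocalStructomorphOn_contDiffGroupoid_iff]
  exact mem_groupoid_of_pregroupoid.1 he

/-- The adapted coordinates on the total space given by a local trivialization of the bundle and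
the chart of the base at `x₀`. -/
def coords (i : 𝔹.ι) (x₀ : M) (a : 𝔹.Total) : E × F :=
  (chartAt E x₀ a.1, 𝔹.triv i a.1 a.2)

/-- The point with given adapted coordinates. -/
def point (i : 𝔹.ι) (x₀ : M) (p : E × F) : 𝔹.Total :=
  ⟨(chartAt E x₀).symm p.1, (𝔹.triv i ((chartAt E x₀).symm p.1)).symm p.2⟩

/-- The open subset of `M` over which the adapted coordinates are defined. -/
def coordDomain (i : 𝔹.ι) (x₀ : M) : Set M := (chartAt E x₀).source ∩ 𝔹.baseSet i

/-- The image of `coordDomain i x₀` in the model space `E`. -/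
def coordTarget (i : 𝔹.ι) (x₀ : M) : Set E :=
  (chartAt E x₀).target ∩ (chartAt E x₀).symm ⁻¹' 𝔹.baseSet i

theorem point_coords {i : 𝔹.ι} {x₀ : M} {a : 𝔹.Total} (ha : a.1 ∈ 𝔹.coordDomain i x₀) :
    𝔹.point i x₀ (𝔹.coords i x₀ a) = a := by
  obtain ⟨x, α⟩ := a
  have hx : (chartAt E x₀).symm (chartAt E x₀ x) = x := (chartAt E x₀).left_inv ha.1
  have key : ∀ z : M, z = x → (⟨z, (𝔹.triv i z).symm (𝔹.triv i x α)⟩ : 𝔹.Total) = ⟨x, α⟩ := by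
    rintro z rfl; simp
  exact key _ hx

theorem contMDiffOn_trivSymm (i : 𝔹.ι) :
    ContMDiffOn (𝓘(ℝ, E).prod 𝓘(ℝ, F)) (𝓘(ℝ, E).prod 𝓘(ℝ, F)) ∞
      (fun p : M × F => (⟨p.1, (𝔹.triv i p.1).symm p.2⟩ : 𝔹.Total)) (𝔹.baseSet i ×ˢ univ) := by
  intro p hp
  refine contMDiffWithinAt_totalSpace.2 ⟨contMDiffWithinAt_fst, ?_⟩
  have h := (𝔹.contMDiffOn_triv i (𝔹.indexAt p.1)) p ⟨⟨hp.1, 𝔹.mem_baseSet_at _⟩, mem_univ _⟩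
  refine h.mono_of_mem_nhdsWithin (mem_nhdsWithin_of_mem_nhds ?_)
  exact (((𝔹.isOpen_baseSet i).inter (𝔹.isOpen_baseSet _)).prod isOpen_univ).mem_nhds
    ⟨⟨hp.1, 𝔹.mem_baseSet_at _⟩, mem_univ _⟩

theorem contMDiffAt_point [IsManifold 𝓘(ℝ, E) ∞ M] (i : 𝔹.ι) (x₀ : M) {p : E × F}
    (hp : p.1 ∈ 𝔹.coordTarget i x₀) :
    ContMDiffAt 𝓘(ℝ, E × F) (𝓘(ℝ, E).prod 𝓘(ℝ, F)) ∞ (𝔹.point i x₀) p := by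
  have h1 : ContMDiffAt 𝓘(ℝ, E) 𝓘(ℝ, E) ∞ (chartAt E x₀).symm p.1 :=
    (contMDiffOn_chart_symm (I := 𝓘(ℝ, E))).contMDiffAt ((chartAt E x₀).open_target.mem_nhds hp.1)
  have h2 : ContMDiffAt 𝓘(ℝ, E × F) (𝓘(ℝ, E).prod 𝓘(ℝ, F)) ∞
      (fun q : E × F => ((chartAt E x₀).symm q.1, q.2)) p :=
    (h1.comp p contDiff_fst.contMDiff.contMDiffAt).prodMk contDiff_snd.contMDiff.contMDiffAt
  have h3 := (𝔹.contMDiffOn_trivSymm i).contMDiffAt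
    (x := ((chartAt E x₀).symm p.1, p.2))
    (((𝔹.isOpen_baseSet i).prod isOpen_univ).mem_nhds ⟨hp.2, mem_univ _⟩)
  exact h3.comp p h2

end AffineBundle

/-! ### Special affine bundles -/

/-- A special affine bundle with model fibre `F × ℝ`: an affine bundle modelled on a special vector
bundle.  In the local trivializations the distinguished section is `(0, 1)`; for `x` outside of
`baseSet i`, where `triv i x` is irrelevant, this is a normalization that can always be achieved. -/
structure SpecialAffineBundle (E : Type*) [NormedAddCommGroup E] [NormedSpace ℝ E]
    (M : Type*) [TopologicalSpace M] [ChartedSpace E M]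
    (F : Type*) [NormedAddCommGroup F] [NormedSpace ℝ F] extends AffineBundle E M (F × ℝ) where
  [special : ∀ x, SpecialVectorSpace (Dir x)]
  triv_vec : ∀ i x, (triv i x).linear (SpecialVectorSpace.vec : Dir x) = (0, 1)

attribute [instance] SpecialAffineBundle.special

namespace SpecialAffineBundle

variable (𝔸 : SpecialAffineBundle E M F)

/-- The quotient bundle of a special affine bundle by its distinguished section. -/
def red : AffineBundle E M F where
  Dir x := 𝔸.Dir x ⧸ line (𝔸.Dir x)
  Fib x := Red (𝔸.Dir x) (𝔸.Fib x)
  ι := 𝔸.ι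
  baseSet := 𝔸.baseSet
  isOpen_baseSet := 𝔸.isOpen_baseSet
  indexAt := 𝔸.indexAt
  mem_baseSet_at := 𝔸.mem_baseSet_at
  triv i x := redCoord (𝔸.triv i x) (𝔸.triv_vec i x)
  contMDiffOn_triv i j := by
    have h : ContMDiffOn (𝓘(ℝ, E).prod 𝓘(ℝ, F)) (𝓘(ℝ, E).prod 𝓘(ℝ, F × ℝ)) ∞
        (fun p : M × F => (p.1, (p.2, (0 : ℝ)))) ((𝔸.baseSet i ∩ 𝔸.baseSet j) ×ˢ univ) :=
      contMDiffOn_fst.prodMk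
        ((contDiff_prodMk_left (0 : ℝ)).contMDiff.comp_contMDiffOn contMDiffOn_snd)
    exact contDiff_fst.contMDiff.comp_contMDiffOn ((𝔸.contMDiffOn_triv i j).comp h
      fun p hp => ⟨hp.1, mem_univ _⟩)

theorem contMDiffOn_clm [FiniteDimensional ℝ F] {H N : Type*} {G : Type*} [NormedAddCommGroup G]
    [NormedSpace ℝ G] [TopologicalSpace H] {I : ModelWithCorners ℝ G H} [TopologicalSpace N]
    [ChartedSpace H N] {f : N → F →L[ℝ] ℝ} {s : Set N}
    (h : ∀ y, ContMDiffOn I 𝓘(ℝ, ℝ) ∞ (fun x => f x y) s) :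
    ContMDiffOn I 𝓘(ℝ, F →L[ℝ] ℝ) ∞ f s := by
  let d := Module.finrank ℝ F
  have hd : d = Module.finrank ℝ (Fin d → ℝ) := by simp [d]
  let e₁ := ContinuousLinearEquiv.ofFinrankEq hd
  let e₂ := (e₁.arrowCongr (1 : ℝ ≃L[ℝ] ℝ)).trans (ContinuousLinearEquiv.piRing (Fin d))
  have h2 : ContMDiffOn I 𝓘(ℝ, Fin d → ℝ) ∞ (e₂ ∘ f) s :=
    contMDiffOn_pi_space.2 fun i => h _
  have h3 := e₂.symm.contDiff.contMDiff.comp_contMDiffOn h2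
  exact h3.congr fun x _ => (e₂.symm_apply_apply (f x)).symm

/-- The special affine dual of a special affine bundle. -/
def dual [FiniteDimensional ℝ F] : SpecialAffineBundle E M (F →L[ℝ] ℝ) where
  Dir x := SDualDir (𝔸.Dir x) (𝔸.Fib x)
  Fib x := SDual (𝔸.Dir x) (𝔸.Fib x)
  ι := 𝔸.ι
  baseSet := 𝔸.baseSet
  isOpen_baseSet := 𝔸.isOpen_baseSet
  indexAt := 𝔸.indexAt
  mem_baseSet_at := 𝔸.mem_baseSet_at
  triv i x := dualCoord (𝔸.triv i x) (𝔸.triv_vec i x)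
  contMDiffOn_triv i j := by
    have hT : ∀ w : F × ℝ, ContMDiffOn (𝓘(ℝ, E).prod 𝓘(ℝ, (F →L[ℝ] ℝ) × ℝ)) 𝓘(ℝ, F × ℝ) ∞
        (fun p : M × ((F →L[ℝ] ℝ) × ℝ) => 𝔸.triv i p.1 ((𝔸.triv j p.1).symm w))
        ((𝔸.baseSet i ∩ 𝔸.baseSet j) ×ˢ univ) := fun w =>
      (𝔸.contMDiffOn_triv j i).comp (contMDiffOn_fst.prodMk contMDiffOn_const)
        fun p hp => ⟨⟨hp.1.2, hp.1.1⟩, mem_univ _⟩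
    have hξ : ContMDiffOn (𝓘(ℝ, E).prod 𝓘(ℝ, (F →L[ℝ] ℝ) × ℝ)) 𝓘(ℝ, F →L[ℝ] ℝ) ∞
        (fun p : M × ((F →L[ℝ] ℝ) × ℝ) => p.2.1) ((𝔸.baseSet i ∩ 𝔸.baseSet j) ×ˢ univ) :=
      contDiff_fst.contMDiff.comp_contMDiffOn contMDiffOn_snd
    have hc : ContMDiffOn (𝓘(ℝ, E).prod 𝓘(ℝ, (F →L[ℝ] ℝ) × ℝ)) 𝓘(ℝ, ℝ) ∞
        (fun p : M × ((F →L[ℝ] ℝ) × ℝ) => p.2.2) ((𝔸.baseSet i ∩ 𝔸.baseSet j) ×ˢ univ) :=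
      contDiff_snd.contMDiff.comp_contMDiffOn contMDiffOn_snd
    have hval : ∀ w : F × ℝ, ContMDiffOn (𝓘(ℝ, E).prod 𝓘(ℝ, (F →L[ℝ] ℝ) × ℝ)) 𝓘(ℝ, ℝ) ∞
        (fun p : M × ((F →L[ℝ] ℝ) × ℝ) =>
          dualFun (𝔸.triv i p.1) p.2.1 p.2.2 ((𝔸.triv j p.1).symm w))
        ((𝔸.baseSet i ∩ 𝔸.baseSet j) ×ˢ univ) := fun w => by
      simp only [dualFun_apply]
      exact ((hξ.clm_apply (contDiff_fst.contMDiff.comp_contMDiffOn (hT w))).add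
        (contDiff_snd.contMDiff.comp_contMDiffOn (hT w))).add hc
    refine ContMDiffOn.prodMk_space (contMDiffOn_clm fun y => ?_) (hval (0, 0))
    refine ((hval (y, 0)).sub (hval (0, 0))).congr fun p _ => ?_
    have h := (dualFun (𝔸.triv i p.1) p.2.1 p.2.2).linearMap_vsub
      ((𝔸.triv j p.1).symm (y, 0)) ((𝔸.triv j p.1).symm (0, 0))
    have h2 : (𝔸.triv j p.1).linear.symm ((y, (0 : ℝ)) - (0, 0)) =
        (𝔸.triv j p.1).symm (y, 0) -ᵥ (𝔸.triv j p.1).symm (0, 0) :=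
      (𝔸.triv j p.1).symm.toAffineMap.linearMap_vsub _ _
    rw [← h2] at h
    refine Eq.trans ?_ h
    change (dualFun (𝔸.triv i p.1) p.2.1 p.2.2).linear
      ((𝔸.triv j p.1).linear.symm (y, 0)) = _
    simp
  triv_vec i x := by
    refine Prod.ext (ContinuousLinearMap.ext fun y => ?_) rfl
    change (AffineMap.const ℝ (𝔸.Fib x) (1 : ℝ)).linear ((𝔸.triv i x).linear.symm (y, 0)) = 0
    simp

/-- The sections of the bundle of affine values of a special affine bundle: smooth sections of the
projection of the special affine bundle onto its quotient. -/
structure AVSection where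
  toFun : ∀ a : 𝔸.red.Total, 𝔸.Fib a.1
  mk_toFun : ∀ a : 𝔸.red.Total, (Red.mk (toFun a) : Red (𝔸.Dir a.1) (𝔸.Fib a.1)) = a.2
  contMDiff : ContMDiff (𝓘(ℝ, E).prod 𝓘(ℝ, F)) (𝓘(ℝ, E).prod 𝓘(ℝ, F × ℝ)) ∞
    (fun a : 𝔸.red.Total => (⟨a.1, toFun a⟩ : 𝔸.Total))

variable {𝔸}

/-- A section as a map between the total spaces. -/
def AVSection.map (σ : 𝔸.AVSection) (a : 𝔸.red.Total) : 𝔸.Total := ⟨a.1, σ.toFun a⟩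

/-- The coordinate expression of a section, in the fibre coordinate of the bundle of affine values
in which its distinguished section, which is *minus* the one of the special affine bundle,
is `1`. -/
def AVSection.localRep (σ : 𝔸.AVSection) (i : 𝔸.ι) (x₀ : M) (p : E × F) : ℝ :=
  -(𝔸.coords i x₀ (σ.map (𝔸.red.point i x₀ p))).2.2

variable (𝔸) in
/-- The equivalence relation defining the phase bundle: `(a, σ)` and `(b, τ)` are equivalent if
`a = b` and the smooth function `f = τ - σ` has zero differential at `a`.  The difference is formed
in the bundle of affine values, whose distinguished section is minus the one of the special affine
bundle. -/
def phaseSetoid : Setoid (𝔸.red.Total × 𝔸.AVSection) where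
  r p q := p.1 = q.1 ∧ ∃ f : 𝔸.red.Total → ℝ,
    ContMDiff (𝓘(ℝ, E).prod 𝓘(ℝ, F)) 𝓘(ℝ, ℝ) ∞ f ∧
    (∀ c, q.2.toFun c = -(f c) • (SpecialVectorSpace.vec : 𝔸.Dir c.1) +ᵥ p.2.toFun c) ∧
    mfderiv (𝓘(ℝ, E).prod 𝓘(ℝ, F)) 𝓘(ℝ, ℝ) f p.1 = 0
  iseqv :=
    { refl := fun p => ⟨rfl, fun _ => 0, contMDiff_const, fun c => by simp,
        (hasMFDerivAt_const (0 : ℝ) p.1).mfderiv⟩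
      symm := by
        rintro ⟨a, σ⟩ ⟨b, τ⟩ ⟨rfl : a = b, f, hf, h, hd⟩
        refine ⟨rfl, fun c => -f c, hf.neg, fun c => ?_, ?_⟩
        · have h' : τ.toFun c = _ := h c
          change σ.toFun c = _
          rw [h', vadd_vadd, ← add_smul]
          simp
        · have := (hf.mdifferentiable (by simp) a).hasMFDerivAt
          rw [hd] at this
          exact this.neg.mfderiv.trans neg_zero
      trans := by
        rintro ⟨a, σ⟩ ⟨b, τ⟩ ⟨c, υ⟩ ⟨rfl : a = b, f, hf, h, hd⟩ ⟨rfl : a = c, g, hg, h', hd'⟩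
        refine ⟨rfl, fun c => f c + g c, hf.add hg, fun c => ?_, ?_⟩
        · have h1 : τ.toFun c = _ := h c
          have h2 : υ.toFun c = _ := h' c
          change υ.toFun c = _
          rw [h2, h1, vadd_vadd, ← add_smul]
          congr 2
          ring
        · have h1 := (hf.mdifferentiable (by simp) a).hasMFDerivAt
          have h2 := (hg.mdifferentiable (by simp) a).hasMFDerivAt
          rw [hd] at h1
          have hd2 : mfderiv (𝓘(ℝ, E).prod 𝓘(ℝ, F)) 𝓘(ℝ, ℝ) g a = 0 := hd'
          rw [hd2] at h2
          exact (h1.add h2).mfderiv.trans (add_zero _) }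

variable (𝔸) in
/-- The (total space of the) affine phase bundle. -/
def Phase : Type _ := Quotient 𝔸.phaseSetoid

/-- The affine de Rham differential of a section. -/
def AVSection.d (σ : 𝔸.AVSection) (a : 𝔸.red.Total) : 𝔸.Phase :=
  Quotient.mk 𝔸.phaseSetoid (a, σ)

/-- The projection of the phase bundle onto the base of the bundle of affine values. -/
def Phase.base (p : 𝔸.Phase) : 𝔸.red.Total :=
  Quotient.liftOn p Prod.fst fun _ _ h => h.1

variable [IsManifold 𝓘(ℝ, E) ∞ M]

theorem fderiv_localRep_eq (i : 𝔸.ι) (x₀ : M) {p q : 𝔸.red.Total × 𝔸.AVSection}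
    (h : 𝔸.phaseSetoid p q) (hp : p.1.1 ∈ 𝔸.coordDomain i x₀) :
    fderiv ℝ (p.2.localRep i x₀) (𝔸.red.coords i x₀ p.1) =
      fderiv ℝ (q.2.localRep i x₀) (𝔸.red.coords i x₀ q.1) := by
  obtain ⟨a, σ⟩ := p
  obtain ⟨b, τ⟩ := q
  obtain ⟨rfl : a = b, f, hf, hτ, hd⟩ := h
  have e : τ.localRep i x₀ = fun r => σ.localRep i x₀ r + f (𝔸.red.point i x₀ r) := by
    funext r
    have h1 : τ.toFun (𝔸.red.point i x₀ r) = _ := hτ (𝔸.red.point i x₀ r)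
    have h2 : (𝔸.triv i (𝔸.red.point i x₀ r).1 (τ.toFun (𝔸.red.point i x₀ r))).2 =
        -f (𝔸.red.point i x₀ r) +
          (𝔸.triv i (𝔸.red.point i x₀ r).1 (σ.toFun (𝔸.red.point i x₀ r))).2 := by
      rw [h1, AffineEquiv.map_vadd, map_smul, 𝔸.triv_vec]
      simp
    change -(𝔸.triv i (𝔸.red.point i x₀ r).1 (τ.toFun (𝔸.red.point i x₀ r))).2 =
      -(𝔸.triv i (𝔸.red.point i x₀ r).1 (σ.toFun (𝔸.red.point i x₀ r))).2 + _
    rw [h2]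
    ring
  have hpt : (𝔸.red.coords i x₀ a).1 ∈ 𝔸.red.coordTarget i x₀ :=
    ⟨(chartAt E x₀).map_source hp.1, by
      change (chartAt E x₀).symm (chartAt E x₀ a.1) ∈ 𝔸.baseSet i
      rw [(chartAt E x₀).left_inv hp.1]; exact hp.2⟩
  have hpc : 𝔸.red.point i x₀ (𝔸.red.coords i x₀ a) = a := 𝔸.red.point_coords hp
  have h0 : HasFDerivAt (fun r => f (𝔸.red.point i x₀ r)) (0 : E × F →L[ℝ] ℝ)
      (𝔸.red.coords i x₀ a) := by
    have h1 := ((𝔸.red.contMDiffAt_point i x₀ hpt).mdifferentiableAt (by simp)).hasMFDerivAt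
    have h2 := (hf.mdifferentiable (by simp) a).hasMFDerivAt
    have hd2 : mfderiv (𝓘(ℝ, E).prod 𝓘(ℝ, F)) 𝓘(ℝ, ℝ) f a = 0 := hd
    rw [hd2] at h2
    rw [← hpc] at h2
    have h3 := h2.comp (𝔸.red.coords i x₀ a) h1
    rw [ContinuousLinearMap.zero_comp] at h3
    exact h3.hasFDerivAt
  change fderiv ℝ (σ.localRep i x₀) (𝔸.red.coords i x₀ a) =
    fderiv ℝ (τ.localRep i x₀) (𝔸.red.coords i x₀ a)
  by_cases hσ : DifferentiableAt ℝ (σ.localRep i x₀) (𝔸.red.coords i x₀ a)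
  · have := (hσ.hasFDerivAt.add h0).fderiv
    rw [add_zero] at this
    rw [e]
    exact this.symm
  · have hτ' : ¬ DifferentiableAt ℝ (τ.localRep i x₀) (𝔸.red.coords i x₀ a) := by
      intro h
      apply hσ
      have h4 := h.sub h0.differentiableAt
      refine h4.congr_of_eventuallyEq (Filter.Eventually.of_forall fun r => ?_)
      rw [e]
      simp
    rw [fderiv_zero_of_not_differentiableAt hσ, fderiv_zero_of_not_differentiableAt hτ']

open Classical in
/-- The coordinates `(p, π)` on the fibres of the phase bundle:
`p = ∂σ/∂x` and `π = ∂σ/∂y` at the differential of `σ`. -/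
def Phase.momenta (i : 𝔸.ι) (x₀ : M) (p : 𝔸.Phase) : (E →L[ℝ] ℝ) × (F →L[ℝ] ℝ) :=
  Quotient.liftOn p
    (fun r => if r.1.1 ∈ 𝔸.coordDomain i x₀ then
      ((fderiv ℝ (r.2.localRep i x₀) (𝔸.red.coords i x₀ r.1)).comp (ContinuousLinearMap.inl ℝ E F),
        (fderiv ℝ (r.2.localRep i x₀) (𝔸.red.coords i x₀ r.1)).comp
          (ContinuousLinearMap.inr ℝ E F)) else 0)
    (by
      intro p q h
      have h1 : p.1 = q.1 := h.1
      by_cases hp : p.1.1 ∈ 𝔸.coordDomain i x₀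
      · have hq : q.1.1 ∈ 𝔸.coordDomain i x₀ := h1 ▸ hp
        simp only [if_pos hp, if_pos hq, fderiv_localRep_eq i x₀ h hp]
      · have hq : q.1.1 ∉ 𝔸.coordDomain i x₀ := h1 ▸ hp
        simp only [if_neg hp, if_neg hq])

variable [FiniteDimensional ℝ F]

/-- The projection of the phase bundle of a special affine bundle onto the quotient of the special
affine dual, which is `(x, y, p, π) ↦ (x, π)` in adapted coordinates. -/
def Phase.dualBase (p : 𝔸.Phase) : 𝔸.dual.red.Total :=
  ⟨p.base.1, (𝔸.dual.red.triv (𝔸.indexAt p.base.1) p.base.1).symm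
    (p.momenta (𝔸.indexAt p.base.1) p.base.1).2⟩

/-- The Legendre map of a Lagrangian section. -/
def AVSection.legendre (L : 𝔸.AVSection) (a : 𝔸.red.Total) : 𝔸.dual.red.Total :=
  (L.d a).dualBase

/-- The graph of the canonical isomorphism from the phase bundle of a special affine bundle onto
the phase bundle of its special affine dual, which is `(x, y, p, π) ↦ (x, π, -p, y)` in adapted
coordinates. -/
def PhaseIso (p : 𝔸.Phase) (q : 𝔸.dual.Phase) : Prop :=
  q.base = p.dualBase ∧ ∀ (i : 𝔸.ι) (x₀ : M), p.base.1 ∈ 𝔸.coordDomain i x₀ →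
    Phase.momenta (𝔸 := 𝔸.dual) i x₀ q = (-(p.momenta i x₀).1,
      ContinuousLinearMap.apply ℝ ℝ (𝔸.red.coords i x₀ p.base).2)

end SpecialAffineBundle

/-! ### Special affgebroids -/

/-- Morphisms `(x, y, z, c) ↦ (x, Φ₁ (x, y), Φ₂ (x, z), Φ₃ (x, y, z, c))` of trivial double affine
bundles over the identity of the base `U`: everything is smooth, `Φ₁`, `Φ₂` are affine in `y`, `z`,
and `Φ₃` is affine in `(z, c)` for fixed `y` and affine in `(y, c)` for fixed `z`. -/
structure IsTrivialDoubleAffineMorphism {X K₁ K₂ K K₁' K₂' K' : Type*}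
    [NormedAddCommGroup X] [NormedSpace ℝ X]
    [NormedAddCommGroup K₁] [NormedSpace ℝ K₁] [NormedAddCommGroup K₂] [NormedSpace ℝ K₂]
    [NormedAddCommGroup K] [NormedSpace ℝ K] [NormedAddCommGroup K₁'] [NormedSpace ℝ K₁']
    [NormedAddCommGroup K₂'] [NormedSpace ℝ K₂'] [NormedAddCommGroup K'] [NormedSpace ℝ K']
    (U : Set X) (Φ₁ : X → K₁ → K₁') (Φ₂ : X → K₂ → K₂') (Φ₃ : X → K₁ → K₂ → K → K') : Prop where
  contDiffOn₁ : ContDiffOn ℝ ∞ (fun p : X × K₁ => Φ₁ p.1 p.2) (U ×ˢ univ)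
  contDiffOn₂ : ContDiffOn ℝ ∞ (fun p : X × K₂ => Φ₂ p.1 p.2) (U ×ˢ univ)
  contDiffOn₃ : ContDiffOn ℝ ∞
    (fun p : X × K₁ × K₂ × K => Φ₃ p.1 p.2.1 p.2.2.1 p.2.2.2) (U ×ˢ univ)
  affine₁ : ∀ x ∈ U, ∃ g : K₁ →ᵃ[ℝ] K₁', ∀ y, Φ₁ x y = g y
  affine₂ : ∀ x ∈ U, ∃ g : K₂ →ᵃ[ℝ] K₂', ∀ z, Φ₂ x z = g z
  affine₃_right : ∀ x ∈ U, ∀ y, ∃ g : K₂ × K →ᵃ[ℝ] K', ∀ z c, Φ₃ x y z c = g (z, c)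
  affine₃_left : ∀ x ∈ U, ∀ z, ∃ g : K₁ × K →ᵃ[ℝ] K', ∀ y c, Φ₃ x y z c = g (y, c)

/-- The adapted coordinates of a tangent vector of the total space of an affine bundle: the
coordinates `(x, z)` of its base point and its components `(ẋ, ż)`. -/
def AffineBundle.tangentCoords (𝔹 : AffineBundle E M F) (i : 𝔹.ι) (x₀ : M)
    (w : TangentBundle (𝓘(ℝ, E).prod 𝓘(ℝ, F)) 𝔹.Total) : (E × F) × (E × F) :=
  (𝔹.coords i x₀ w.proj,
    mfderiv (𝓘(ℝ, E).prod 𝓘(ℝ, F)) 𝓘(ℝ, E × F) (𝔹.coords i x₀) w.proj w.2)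

variable [IsManifold 𝓘(ℝ, E) ∞ M] [FiniteDimensional ℝ F]

/-- The tangent bundle of the quotient of the special affine dual. -/
abbrev SpecialAffineBundle.DualTangent (𝔸 : SpecialAffineBundle E M F) : Type _ :=
  TangentBundle (𝓘(ℝ, E).prod 𝓘(ℝ, F →L[ℝ] ℝ)) 𝔸.dual.red.Total

/-- A (general) special affgebroid on a special affine bundle: a morphism of double affine bundles
from the phase bundle of the special affine bundle to the tangent bundle of the quotient of the
special affine dual, covering the identity on that quotient. In adapted coordinates it is
`(x, y, p, π) ↦ (x, π, Φ₁ (x, y), Φ₃ (x, y, π, p))`. -/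
structure SpecialAffgebroid (𝔸 : SpecialAffineBundle E M F) where
  toFun : 𝔸.Phase → 𝔸.DualTangent
  proj_toFun : ∀ p, (toFun p).proj = p.dualBase
  isMorphism : ∀ (i : 𝔸.ι) (x₀ : M), ∃ (Φ₁ : E → F → E)
    (Φ₃ : E → F → (F →L[ℝ] ℝ) → (E →L[ℝ] ℝ) → (F →L[ℝ] ℝ)),
    IsTrivialDoubleAffineMorphism (𝔸.coordTarget i x₀) Φ₁
      (fun _ (ξ : F →L[ℝ] ℝ) => ξ) Φ₃ ∧
    ∀ p : 𝔸.Phase, p.base.1 ∈ 𝔸.coordDomain i x₀ →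
      𝔸.dual.red.tangentCoords i x₀ (toFun p) =
        (((𝔸.red.coords i x₀ p.base).1, (p.momenta i x₀).2),
         (Φ₁ (𝔸.red.coords i x₀ p.base).1 (𝔸.red.coords i x₀ p.base).2,
          Φ₃ (𝔸.red.coords i x₀ p.base).1 (𝔸.red.coords i x₀ p.base).2
            (p.momenta i x₀).2 (p.momenta i x₀).1))

namespace SpecialAffgebroid

variable {𝔸 : SpecialAffineBundle E M F} (ℰ : SpecialAffgebroid 𝔸)

open Classical in
/-- The morphism from the phase bundle of the special affine dual obtained from a special
affgebroid by composition with the inverse of the canonical isomorphism of phase bundles (every `q` has exactly one preimage, so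
that the second case does not occur). -/
def tensorMap (q : 𝔸.dual.Phase) : 𝔸.DualTangent :=
  if h : ∃ p : 𝔸.Phase, SpecialAffineBundle.PhaseIso p q then ℰ.toFun h.choose else ⟨q.base, 0⟩

/-- The bracket `{σ, f}` of a section of the bundle of affine values of the special affine dual and
a function on its base. -/
def bracket (σ : 𝔸.dual.AVSection) (f : 𝔸.dual.red.Total → ℝ) (φ : 𝔸.dual.red.Total) : ℝ :=
  mfderiv (𝓘(ℝ, E).prod 𝓘(ℝ, F →L[ℝ] ℝ)) 𝓘(ℝ, ℝ) f (ℰ.tensorMap (σ.d φ)).proj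
    (ℰ.tensorMap (σ.d φ)).2

/-- `X` is the Hamiltonian vector field of `H`, i.e. the smooth vector field associated with the
derivation `{H, ·}`. -/
structure IsHamiltonianVectorField (H : 𝔸.dual.AVSection)
    (X : ∀ φ : 𝔸.dual.red.Total, TangentSpace (𝓘(ℝ, E).prod 𝓘(ℝ, F →L[ℝ] ℝ)) φ) : Prop where
  contMDiff : ContMDiff (𝓘(ℝ, E).prod 𝓘(ℝ, F →L[ℝ] ℝ)) (𝓘(ℝ, E).prod 𝓘(ℝ, F →L[ℝ] ℝ)).tangent ∞
    (fun φ => (⟨φ, X φ⟩ : 𝔸.DualTangent))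
  bracket_eq : ∀ f : 𝔸.dual.red.Total → ℝ,
    ContMDiff (𝓘(ℝ, E).prod 𝓘(ℝ, F →L[ℝ] ℝ)) 𝓘(ℝ, ℝ) ∞ f → ∀ φ,
      mfderiv (𝓘(ℝ, E).prod 𝓘(ℝ, F →L[ℝ] ℝ)) 𝓘(ℝ, ℝ) f φ (X φ) = ℰ.bracket H f φ

/-- The dynamics defined by a Lagrangian section: the image under `ℰ` of the image of its affine
de Rham differential. -/
def dynamics (L : 𝔸.AVSection) : Set 𝔸.DualTangent := ℰ.toFun '' range L.d

/-- `H` is a Hamiltonian associated with the Lagrangian `L`: the dynamics of `L` is the image of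
the Hamiltonian vector field of `H`. -/
def IsHamiltonian (L : 𝔸.AVSection) (H : 𝔸.dual.AVSection) : Prop :=
  ∃ X : ∀ φ : 𝔸.dual.red.Total, TangentSpace (𝓘(ℝ, E).prod 𝓘(ℝ, F →L[ℝ] ℝ)) φ,
    ℰ.IsHamiltonianVectorField H X ∧
    range (fun φ => (⟨φ, X φ⟩ : 𝔸.DualTangent)) = ℰ.dynamics L

end SpecialAffgebroid

/-! ### The affine Legendre transformation -/

namespace SpecialAffineBundle

variable {𝔸 : SpecialAffineBundle E M F}

/-- The affine subspace of the fibre that is tangent, at the value `L a`, to the image of the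
restriction of the section `L` to the fibre of the quotient bundle through `a`.  Its direction is
spanned by the velocities at `t = 0` of the curves `t ↦ L (a + t u)`. -/
def AVSection.tangentSubspace (L : 𝔸.AVSection) (a : 𝔸.red.Total) :
    AffineSubspace ℝ (𝔸.Fib a.1) :=
  AffineSubspace.mk' (L.toFun a) (Submodule.span ℝ
    {w : 𝔸.Dir a.1 | ∃ u : 𝔸.red.Dir a.1, ∀ ψ : 𝔸.Dir a.1 →ₗ[ℝ] ℝ,
      HasDerivAt (fun t : ℝ => ψ (L.toFun ⟨a.1, t • u +ᵥ a.2⟩ -ᵥ L.toFun a)) (ψ w) 0})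

/-- The special affine function `φ` on the fibre over `a` vanishes on the affine subspace tangent
to the image of `L` at `L a`. -/
def AVSection.VanishesOnTangent (L : 𝔸.AVSection) (a : 𝔸.red.Total)
    (φ : SDual (𝔸.Dir a.1) (𝔸.Fib a.1)) : Prop :=
  ∀ b ∈ L.tangentSubspace a, φ.1 b = 0

/-- The map assigning to `a` the special affine function that vanishes on the affine subspace
tangent to the image of `L` at `L a`. -/
def AVSection.hat (L : 𝔸.AVSection) (a : 𝔸.red.Total) : 𝔸.dual.Total :=
  ⟨a.1, Classical.epsilon fun φ : SDual (𝔸.Dir a.1) (𝔸.Fib a.1) => L.VanishesOnTangent a φ⟩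

end SpecialAffineBundle
end Bundle
end SpecialAffine

end

open SpecialAffine SpecialAffine.SpecialAffineBundle

noncomputable section

namespace SpecialAffine

variable {E : Type*} [NormedAddCommGroup E] [NormedSpace ℝ E]
  {M : Type*} [TopologicalSpace M] [ChartedSpace E M]
  {F : Type*} [NormedAddCommGroup F] [NormedSpace ℝ F]

/-! ### Adapted coordinates on an affine bundle -/

namespace AffineBundle

variable (𝔹 : AffineBundle E M F)

/-! This is the classical Legendre transformation, read affinely. Write ℓ for the coordinate
expression of `L`; a special affine function is `(y, s) ↦ ξ y + s + c`, where the section sits at `s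
= -ℓ(x, y)` because the distinguished vector is `-∂/∂y^m`. Vanishing on the tangent subspace at `L
a` means vanishing at `L a` and along the velocities `(η, -dℓ η)`, which forces `ξ = ∂ℓ/∂y` and `c =
ℓ - y ∂ℓ/∂y`. So the function exists and is unique (`vanishesOnTangent_iff`), depends smoothly on
`a` (`contMDiff_hat`), and its class modulo constants is the Legendre image of `a`
(`legendre_eq_mk_hat`). Composing with the inverse Legendre map therefore gives a section `H` over
the reduced dual, with `ξ₀ = -c`, i.e. the usual formula for the Hamiltonian.

Differentiating this formula, the contribution of the derivative of the inverse Legendre map along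
the fibres cancels, which leaves `∂H/∂x = -∂ℓ/∂x` and `∂H/∂ξ = y`
(`hasFDerivAt_localRep_of_map_eq_hat`). This says precisely that the canonical isomorphism of phase
bundles carries `L.d a` to `H.d (leg a)` (`phaseIso_of_map_eq_hat`).

Since that isomorphism is injective (`PhaseIso.left_unique`), the affgebroid composed with its
inverse sends `H.d (leg a)` to `ℰ.toFun (L.d a)`. The Hamiltonian vector field is thus `φ ↦ ℰ.toFun
(L.d (leg.symm φ))`: it is smooth because `ℰ` is smooth in coordinates, and its image is the
dynamics because the Legendre map is bijective. -/

theorem isOpen_coordDomain (i : 𝔹.ι) (x₀ : M) : IsOpen (𝔹.coordDomain i x₀) :=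
  (chartAt E x₀).open_source.inter (𝔹.isOpen_baseSet i)

theorem isOpen_coordTarget (i : 𝔹.ι) (x₀ : M) : IsOpen (𝔹.coordTarget i x₀) :=
  (chartAt E x₀).isOpen_inter_preimage_symm (𝔹.isOpen_baseSet i)

theorem mem_coordDomain_at (x : M) : x ∈ 𝔹.coordDomain (𝔹.indexAt x) x :=
  ⟨mem_chart_source E x, 𝔹.mem_baseSet_at x⟩

variable {𝔹} in
theorem chartAt_mem_coordTarget {i : 𝔹.ι} {x₀ x : M} (hx : x ∈ 𝔹.coordDomain i x₀) :
    chartAt E x₀ x ∈ 𝔹.coordTarget i x₀ :=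
  ⟨(chartAt E x₀).map_source hx.1, by
    change (chartAt E x₀).symm (chartAt E x₀ x) ∈ 𝔹.baseSet i
    rw [(chartAt E x₀).left_inv hx.1]; exact hx.2⟩

variable {𝔹} in
theorem chartAt_symm_mem_coordDomain {i : 𝔹.ι} {x₀ : M} {x : E} (hx : x ∈ 𝔹.coordTarget i x₀) :
    (chartAt E x₀).symm x ∈ 𝔹.coordDomain i x₀ :=
  ⟨(chartAt E x₀).map_target hx.1, hx.2⟩

variable {𝔹} in
theorem coords_point {i : 𝔹.ι} {x₀ : M} {p : E × F} (hp : p.1 ∈ 𝔹.coordTarget i x₀) :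
    𝔹.coords i x₀ (𝔹.point i x₀ p) = p :=
  Prod.ext ((chartAt E x₀).right_inv hp.1) ((𝔹.triv i _).apply_symm_apply p.2)

theorem continuous_fst : Continuous (fun a : 𝔹.Total => a.1) :=
  FiberBundle.continuous_proj F 𝔹.Fib

/-- The manifold structure makes the preferred trivialization at `a.1` smooth by construction; any
other one differs from it by a smooth transition map. -/
theorem contMDiffAt_triv {i : 𝔹.ι} {a : 𝔹.Total} (ha : a.1 ∈ 𝔹.baseSet i) :
    ContMDiffAt (𝓘(ℝ, E).prod 𝓘(ℝ, F)) 𝓘(ℝ, F) ∞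
      (fun b : 𝔹.Total => 𝔹.triv i b.1 b.2) a := by
  have h1 := contMDiffAt_totalSpace.1 (contMDiffAt_id (I := 𝓘(ℝ, E).prod 𝓘(ℝ, F)) (n := ∞)
    (x := a))
  have h2 : ContMDiffAt (𝓘(ℝ, E).prod 𝓘(ℝ, F)) (𝓘(ℝ, E).prod 𝓘(ℝ, F)) ∞
      (fun b : 𝔹.Total => (b.1, 𝔹.triv (𝔹.indexAt a.1) b.1 b.2)) a := h1.1.prodMk h1.2
  have h3 := (𝔹.contMDiffOn_triv (𝔹.indexAt a.1) i).contMDiffAt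
    (x := (a.1, 𝔹.triv (𝔹.indexAt a.1) a.1 a.2))
    ((((𝔹.isOpen_baseSet _).inter (𝔹.isOpen_baseSet i)).prod isOpen_univ).mem_nhds
      ⟨⟨𝔹.mem_baseSet_at _, ha⟩, mem_univ _⟩)
  refine (h3.comp a h2).congr_of_eventuallyEq (Filter.Eventually.of_forall fun b => ?_)
  simp

theorem contMDiffAt_coords [IsManifold 𝓘(ℝ, E) ∞ M] {i : 𝔹.ι} {x₀ : M} {a : 𝔹.Total}
    (ha : a.1 ∈ 𝔹.coordDomain i x₀) :
    ContMDiffAt (𝓘(ℝ, E).prod 𝓘(ℝ, F)) 𝓘(ℝ, E × F) ∞ (𝔹.coords i x₀) a := by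
  have h1 : ContMDiffAt 𝓘(ℝ, E) 𝓘(ℝ, E) ∞ (chartAt E x₀) a.1 :=
    (contMDiffOn_chart (I := 𝓘(ℝ, E))).contMDiffAt ((chartAt E x₀).open_source.mem_nhds ha.1)
  have h2 : ContMDiffAt (𝓘(ℝ, E).prod 𝓘(ℝ, F)) 𝓘(ℝ, E) ∞ (fun b : 𝔹.Total => b.1) a :=
    (contMDiffAt_totalSpace.1 contMDiffAt_id).1
  exact (h1.comp a h2).prodMk_space (𝔹.contMDiffAt_triv ha.2)

/-- Two points of the total space with the same base point and the same fibre coordinate agree. -/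
theorem total_ext {a b : 𝔹.Total} (h : a.1 = b.1) (i : 𝔹.ι)
    (h2 : 𝔹.triv i a.1 a.2 = 𝔹.triv i b.1 b.2) : a = b := by
  obtain ⟨x, a⟩ := a
  obtain ⟨y, b⟩ := b
  obtain rfl : x = y := h
  exact congrArg _ ((𝔹.triv i x).injective h2)

end AffineBundle

/-! ### Sections of the bundle of affine values, in coordinates and along the fibres -/

namespace SpecialAffineBundle

variable {𝔸 : SpecialAffineBundle E M F}

namespace AVSection

/-- The coordinate expression of the restriction of a section to a fibre. -/
def fiberRep (σ : 𝔸.AVSection) (i : 𝔸.ι) (x : M) (y : F) : ℝ :=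
  -(𝔸.triv i x (σ.toFun (⟨x, (𝔸.red.triv i x).symm y⟩ : 𝔸.red.Total))).2

theorem localRep_apply (σ : 𝔸.AVSection) (i : 𝔸.ι) (x₀ : M) (p : E × F) :
    σ.localRep i x₀ p = σ.fiberRep i ((chartAt E x₀).symm p.1) p.2 := rfl

theorem triv_toFun (σ : 𝔸.AVSection) (i : 𝔸.ι) (a : 𝔸.red.Total) :
    𝔸.triv i a.1 (σ.toFun a) =
      (𝔸.red.triv i a.1 a.2, -σ.fiberRep i a.1 (𝔸.red.triv i a.1 a.2)) := by
  refine Prod.ext ?_ ?_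
  · have h := congrArg (𝔸.red.triv i a.1) (σ.mk_toFun a)
    exact h
  · have h : (⟨a.1, (𝔸.red.triv i a.1).symm (𝔸.red.triv i a.1 a.2)⟩ : 𝔸.red.Total) = a := by
      rw [AffineEquiv.symm_apply_apply]
    -- `σ.toFun` is dependent, so the equality of points is used through a statement quantified over
    -- `b`.
    have h2 : ∀ b : 𝔸.red.Total, b = a →
        (𝔸.triv i b.1 (σ.toFun b)).2 = (𝔸.triv i a.1 (σ.toFun a)).2 := by rintro _ rfl; rfl
    exact (h2 _ h).symm.trans (neg_neg _).symm

variable [IsManifold 𝓘(ℝ, E) ∞ M]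

theorem contDiffAt_localRep (σ : 𝔸.AVSection) {i : 𝔸.ι} {x₀ : M} {p : E × F}
    (hp : p.1 ∈ 𝔸.coordTarget i x₀) : ContDiffAt ℝ ∞ (σ.localRep i x₀) p := by
  have h1 : ContMDiffAt 𝓘(ℝ, E × F) (𝓘(ℝ, E).prod 𝓘(ℝ, F)) ∞ (𝔸.red.point i x₀) p :=
    𝔸.red.contMDiffAt_point i x₀ hp
  have h2 := (σ.contMDiff (𝔸.red.point i x₀ p)).comp p h1
  have h3 : ContMDiffAt (𝓘(ℝ, E).prod 𝓘(ℝ, F × ℝ)) 𝓘(ℝ, E × F × ℝ) ∞ (𝔸.coords i x₀)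
      (σ.map (𝔸.red.point i x₀ p)) :=
    𝔸.contMDiffAt_coords (AffineBundle.chartAt_symm_mem_coordDomain hp)
  have h4 : ContDiffAt ℝ ∞ (fun q => 𝔸.coords i x₀ (σ.map (𝔸.red.point i x₀ q))) p :=
    (ContMDiffAt.comp (g := 𝔸.coords i x₀)
      (f := fun q => σ.map (𝔸.red.point i x₀ q)) p h3 h2).contDiffAt
  exact h4.snd.snd.neg

theorem differentiableAt_localRep (σ : 𝔸.AVSection) {i : 𝔸.ι} {x₀ : M} {p : E × F}
    (hp : p.1 ∈ 𝔸.coordTarget i x₀) : DifferentiableAt ℝ (σ.localRep i x₀) p :=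
  (σ.contDiffAt_localRep hp).differentiableAt (by simp)

theorem differentiableAt_fiberRep (σ : 𝔸.AVSection) {i : 𝔸.ι} {x : M} (hx : x ∈ 𝔸.baseSet i)
    (y : F) : DifferentiableAt ℝ (σ.fiberRep i x) y := by
  have h0 : x ∈ 𝔸.coordDomain i x := ⟨mem_chart_source E x, hx⟩
  have h1 := σ.differentiableAt_localRep (p := (chartAt E x x, y))
    (AffineBundle.chartAt_mem_coordTarget h0)
  have h2 := h1.comp y (differentiableAt_const _ |>.prodMk differentiableAt_id :
    DifferentiableAt ℝ (fun y : F => (chartAt E x x, y)) y)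
  refine h2.congr_of_eventuallyEq (Filter.Eventually.of_forall fun z => ?_)
  change _ = σ.fiberRep i ((chartAt E x).symm (chartAt E x x)) z
  rw [(chartAt E x).left_inv h0.1]

/-- Connects the momentum `π`, defined through the chart of the base, with the derivative along a
single fibre, where the tangent subspace lives. -/
theorem fderiv_localRep_inr (σ : 𝔸.AVSection) {i : 𝔸.ι} {x₀ : M} {p : E × F}
    (hp : p.1 ∈ 𝔸.coordTarget i x₀) :
    (fderiv ℝ (σ.localRep i x₀) p).comp (ContinuousLinearMap.inr ℝ E F) =
      fderiv ℝ (σ.fiberRep i ((chartAt E x₀).symm p.1)) p.2 := by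
  have h := HasFDerivAt.comp (f := fun y => (p.1, y)) p.2
    (σ.differentiableAt_localRep hp).hasFDerivAt (hasFDerivAt_prodMk_right p.1 p.2)
  exact h.fderiv.symm

/-! ### The section of the dual bundle defined by a Lagrangian section -/

variable (L : 𝔸.AVSection)

/-- In coordinates the curve is `t ↦ (y + t η, -ℓ(y + t η))`, with velocity `(η, -dℓ η)` at `0`. -/
theorem hasDerivAt_coord_curve {i : 𝔸.ι} {a : 𝔸.red.Total} (ha : a.1 ∈ 𝔸.baseSet i)
    (u : 𝔸.red.Dir a.1) (ψ : 𝔸.Dir a.1 →ₗ[ℝ] ℝ) [FiniteDimensional ℝ F] :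
    HasDerivAt (fun t : ℝ => ψ (L.toFun ⟨a.1, t • u +ᵥ a.2⟩ -ᵥ L.toFun a))
      (ψ ((𝔸.triv i a.1).linear.symm ((𝔸.red.triv i a.1).linear u,
        -fderiv ℝ (L.fiberRep i a.1) (𝔸.red.triv i a.1 a.2)
          ((𝔸.red.triv i a.1).linear u)))) 0 := by
  set e := 𝔸.triv i a.1
  set η := (𝔸.red.triv i a.1).linear u
  set y := 𝔸.red.triv i a.1 a.2
  have key : ∀ t : ℝ, L.toFun ⟨a.1, t • u +ᵥ a.2⟩ -ᵥ L.toFun a =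
      e.linear.symm (t • η, -(L.fiberRep i a.1 (t • η + y) - L.fiberRep i a.1 y)) := by
    intro t
    apply e.linear.injective
    have h1 : e.linear (L.toFun ⟨a.1, t • u +ᵥ a.2⟩ -ᵥ L.toFun a) =
      e (L.toFun ⟨a.1, t • u +ᵥ a.2⟩) - e (L.toFun a) := e.toAffineMap.linearMap_vsub _ _
    have h2 := L.triv_toFun i ⟨a.1, t • u +ᵥ a.2⟩
    have h3 : 𝔸.red.triv i a.1 (t • u +ᵥ a.2) = t • η + y := by
      rw [AffineEquiv.map_vadd, map_smul, vadd_eq_add]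
    have h4 : e (L.toFun ⟨a.1, t • u +ᵥ a.2⟩) = (t • η + y, -L.fiberRep i a.1 (t • η + y)) := by
      rw [← h3]; exact h2
    rw [h1, h4, L.triv_toFun i a, e.linear.apply_symm_apply]
    ext
    · simp [y]
    · simp [y]
      ring
  -- The fibre directions carry no norm; read in coordinates, `ψ` is continuous by finite
  -- dimensionality, so the chain rule applies.
  let ψ' : F × ℝ →L[ℝ] ℝ := LinearMap.toContinuousLinearMap (ψ ∘ₗ (e.linear.symm : F × ℝ →ₗ[ℝ] _))
  have hc : HasDerivAt (fun t : ℝ => t • η) η 0 := by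
    simpa using (hasDerivAt_id (0 : ℝ)).smul_const η
  have hl : HasFDerivAt (L.fiberRep i a.1) (fderiv ℝ (L.fiberRep i a.1) y)
      ((fun t : ℝ => t • η + y) 0) := by
    simpa using (L.differentiableAt_fiberRep ha y).hasFDerivAt
  have hd := hl.comp_hasDerivAt (0 : ℝ) (hc.add_const y)
  have hd2 := hc.prodMk (hd.sub_const (L.fiberRep i a.1 y)).neg
  have := ψ'.hasFDerivAt.comp_hasDerivAt (0 : ℝ) hd2
  refine this.congr_of_eventuallyEq (Filter.Eventually.of_forall fun t => ?_)
  change ψ _ = _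
  rw [key]
  rfl

theorem momenta_d {i : 𝔸.ι} {x₀ : M} {a : 𝔸.red.Total} (ha : a.1 ∈ 𝔸.coordDomain i x₀) :
    (L.d a).momenta i x₀ =
      ((fderiv ℝ (L.localRep i x₀) (𝔸.red.coords i x₀ a)).comp (ContinuousLinearMap.inl ℝ E F),
        (fderiv ℝ (L.localRep i x₀) (𝔸.red.coords i x₀ a)).comp
          (ContinuousLinearMap.inr ℝ E F)) :=
  if_pos ha

theorem momenta_d_snd {i : 𝔸.ι} {x₀ : M} {a : 𝔸.red.Total} (ha : a.1 ∈ 𝔸.coordDomain i x₀) :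
    ((L.d a).momenta i x₀).2 = fderiv ℝ (L.fiberRep i a.1) (𝔸.red.triv i a.1 a.2) := by
  rw [L.momenta_d ha]
  have h1 := L.fderiv_localRep_inr (i := i) (x₀ := x₀) (p := 𝔸.red.coords i x₀ a)
    (AffineBundle.chartAt_mem_coordTarget ha)
  rw [show (chartAt E x₀).symm (𝔸.red.coords i x₀ a).1 = a.1 from
    (chartAt E x₀).left_inv ha.1] at h1
  exact h1

variable [FiniteDimensional ℝ F]

/-- For `φ = ξ y + s + c`, the tangent directions `(η, -dℓ η)` determine `ξ`, and the value at `L a`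
then determines `c`. -/
theorem vanishesOnTangent_iff {i : 𝔸.ι} {a : 𝔸.red.Total} (ha : a.1 ∈ 𝔸.baseSet i)
    (φ : SDual (𝔸.Dir a.1) (𝔸.Fib a.1)) :
    L.VanishesOnTangent a φ ↔ 𝔸.dual.triv i a.1 φ =
      (fderiv ℝ (L.fiberRep i a.1) (𝔸.red.triv i a.1 a.2),
        L.fiberRep i a.1 (𝔸.red.triv i a.1 a.2) -
          fderiv ℝ (L.fiberRep i a.1) (𝔸.red.triv i a.1 a.2) (𝔸.red.triv i a.1 a.2)) := by
  have hφ0 : ∃ q, 𝔸.dual.triv i a.1 φ = q := ⟨_, rfl⟩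
  obtain ⟨⟨ξ, c⟩, hq⟩ := hφ0
  have hφ : φ.1 = dualFun (𝔸.triv i a.1) ξ c := by
    have : φ = (𝔸.dual.triv i a.1).symm (ξ, c) := by
      rw [← hq]; exact (AffineEquiv.symm_apply_apply _ φ).symm
    exact congrArg Subtype.val this
  rw [hq]
  set y := 𝔸.red.triv i a.1 a.2 with hy
  set ℓ := L.fiberRep i a.1
  have hv : φ.1 (L.toFun a) = ξ y - ℓ y + c := by
    rw [hφ, dualFun_apply, L.triv_toFun i a]; simp [sub_eq_add_neg, ℓ, y]
  have hlin : ∀ w, φ.1.linear w = ξ ((𝔸.triv i a.1).linear w).1 + ((𝔸.triv i a.1).linear w).2 := by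
    intro w; rw [hφ]; simp [dualFun]
  have hder := fun u ψ => L.hasDerivAt_coord_curve ha u ψ
  constructor
  · intro h
    have h0 : φ.1 (L.toFun a) = 0 := h _ (AffineSubspace.self_mem_mk' _ _)
    have hξ : ξ = fderiv ℝ ℓ y := by
      ext η
      -- Test point: `L a` displaced by the velocity of the curve in the direction `η`.
      have hw := h ((𝔸.triv i a.1).linear.symm (η, -fderiv ℝ ℓ y η) +ᵥ L.toFun a) (by
        refine AffineSubspace.vadd_mem_mk' _ (Submodule.subset_span
          ⟨(𝔸.red.triv i a.1).linear.symm η, fun ψ => ?_⟩)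
        have := hder ((𝔸.red.triv i a.1).linear.symm η) ψ
        rwa [LinearEquiv.apply_symm_apply] at this)
      rw [AffineMap.map_vadd, h0, hlin, LinearEquiv.apply_symm_apply] at hw
      simp only [vadd_eq_add, add_zero] at hw
      linarith
    rw [hv] at h0
    rw [← hξ]
    exact Prod.ext rfl (by simp only; linarith)
  · intro h b hb
    obtain ⟨rfl, hc⟩ := Prod.mk.inj h
    have h0 : φ.1 (L.toFun a) = 0 := by rw [hv, hc]; ring
    -- It suffices to kill the generators; testing them with `ψ = φ.1.linear`, uniqueness of
    -- derivatives gives the value `ξ η - dℓ η = 0`.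
    have hle : Submodule.span ℝ {w : 𝔸.Dir a.1 | ∃ u : 𝔸.red.Dir a.1, ∀ ψ : 𝔸.Dir a.1 →ₗ[ℝ] ℝ,
        HasDerivAt (fun t : ℝ => ψ (L.toFun ⟨a.1, t • u +ᵥ a.2⟩ -ᵥ L.toFun a)) (ψ w) 0} ≤
        LinearMap.ker φ.1.linear := by
      refine Submodule.span_le.2 ?_
      rintro w ⟨u, hu⟩
      have := (hu φ.1.linear).unique (hder u φ.1.linear)
      refine this.trans ?_
      rw [hlin, LinearEquiv.apply_symm_apply]
      exact add_neg_cancel _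
    have h1 : φ.1.linear (b -ᵥ L.toFun a) = 0 := hle ((AffineSubspace.mem_mk').1 hb)
    rw [φ.1.linearMap_vsub, h0] at h1
    simpa using h1

theorem existsUnique_vanishesOnTangent (a : 𝔸.red.Total) : ∃! φ, L.VanishesOnTangent a φ := by
  refine ⟨(𝔸.dual.triv (𝔸.indexAt a.1) a.1).symm _,
    (L.vanishesOnTangent_iff (𝔸.mem_baseSet_at a.1) _).2 (AffineEquiv.apply_symm_apply _ _),
    fun φ h => ?_⟩
  rw [← (L.vanishesOnTangent_iff (𝔸.mem_baseSet_at a.1) φ).1 h]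
  exact (AffineEquiv.symm_apply_apply _ φ).symm

theorem triv_hat {i : 𝔸.ι} {a : 𝔸.red.Total} (ha : a.1 ∈ 𝔸.baseSet i) :
    𝔸.dual.triv i a.1 (L.hat a).2 =
      (fderiv ℝ (L.fiberRep i a.1) (𝔸.red.triv i a.1 a.2),
        L.fiberRep i a.1 (𝔸.red.triv i a.1 a.2) -
          fderiv ℝ (L.fiberRep i a.1) (𝔸.red.triv i a.1 a.2) (𝔸.red.triv i a.1 a.2)) :=
  (L.vanishesOnTangent_iff ha _).1
    (Classical.epsilon_spec (L.existsUnique_vanishesOnTangent a).exists)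

/-- Exhibits `hat` locally as a composite of maps that are visibly smooth; the choice made by
`epsilon` has disappeared. -/
theorem hat_eq_point {i : 𝔸.ι} {x₀ : M} {a : 𝔸.red.Total} (ha : a.1 ∈ 𝔸.coordDomain i x₀) :
    L.hat a = 𝔸.dual.point i x₀ ((𝔸.red.coords i x₀ a).1,
      ((fderiv ℝ (L.localRep i x₀) (𝔸.red.coords i x₀ a)).comp (ContinuousLinearMap.inr ℝ E F),
        L.localRep i x₀ (𝔸.red.coords i x₀ a) -
          fderiv ℝ (L.localRep i x₀) (𝔸.red.coords i x₀ a) (0, (𝔸.red.coords i x₀ a).2))) := by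
  have ht : (𝔸.red.coords i x₀ a).1 ∈ 𝔸.coordTarget i x₀ :=
    AffineBundle.chartAt_mem_coordTarget ha
  have hx : (chartAt E x₀).symm (𝔸.red.coords i x₀ a).1 = a.1 := (chartAt E x₀).left_inv ha.1
  have h1 := L.fderiv_localRep_inr ht
  have h2 : fderiv ℝ (L.localRep i x₀) (𝔸.red.coords i x₀ a) (0, (𝔸.red.coords i x₀ a).2) =
    (fderiv ℝ (L.localRep i x₀) (𝔸.red.coords i x₀ a)).comp (ContinuousLinearMap.inr ℝ E F)
      (𝔸.red.coords i x₀ a).2 := rfl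
  rw [h2, h1, localRep_apply, hx]
  refine 𝔸.dual.total_ext hx.symm i ((L.triv_hat ha.2).trans ?_)
  exact (AffineEquiv.apply_symm_apply _ _).symm

theorem contMDiff_hat :
    ContMDiff (𝓘(ℝ, E).prod 𝓘(ℝ, F)) (𝓘(ℝ, E).prod 𝓘(ℝ, (F →L[ℝ] ℝ) × ℝ)) ∞ L.hat := by
  intro a
  have ha := 𝔸.mem_coordDomain_at a.1
  set i := 𝔸.indexAt a.1
  have ht : (𝔸.red.coords i a.1 a).1 ∈ 𝔸.coordTarget i a.1 :=
    AffineBundle.chartAt_mem_coordTarget ha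
  have h1 := L.contDiffAt_localRep ht
  have h2 : ContDiffAt ℝ ∞ (fderiv ℝ (L.localRep i a.1)) (𝔸.red.coords i a.1 a) :=
    h1.fderiv_right (by simp)
  have h3 : ContDiffAt ℝ ∞ (fun p : E × F => (p.1,
      ((fderiv ℝ (L.localRep i a.1) p).comp (ContinuousLinearMap.inr ℝ E F),
        L.localRep i a.1 p - fderiv ℝ (L.localRep i a.1) p (0, p.2)))) (𝔸.red.coords i a.1 a) :=
    contDiffAt_fst.prodMk ((h2.clm_comp contDiffAt_const).prodMk
      (h1.sub (h2.clm_apply (contDiffAt_const.prodMk contDiffAt_snd))))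
  have h4 : ContMDiffAt (𝓘(ℝ, E).prod 𝓘(ℝ, F)) 𝓘(ℝ, E × F) ∞ (𝔸.red.coords i a.1) a :=
    𝔸.red.contMDiffAt_coords ha
  have h5 := ContMDiffAt.comp a (𝔸.dual.contMDiffAt_point i a.1 (p := (_, _)) ht)
    (h3.contMDiffAt.comp a h4)
  refine h5.congr_of_eventuallyEq ?_
  filter_upwards [𝔸.red.continuous_fst.continuousAt.preimage_mem_nhds
    ((𝔸.isOpen_coordDomain i a.1).mem_nhds ha)] with b hb
  exact L.hat_eq_point hb

/-- Both sides have fibre coordinate `∂ℓ/∂y`: reduction of the dual forgets only the constant `c`.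
This is what makes the composite with the inverse Legendre map a section. -/
theorem legendre_eq_mk_hat (a : 𝔸.red.Total) :
    L.legendre a = (⟨a.1, Red.mk (L.hat a).2⟩ : 𝔸.dual.red.Total) := by
  refine 𝔸.dual.red.total_ext rfl (𝔸.indexAt a.1) ?_
  refine (AffineEquiv.apply_symm_apply _ _).trans ?_
  refine (L.momenta_d_snd (𝔸.mem_coordDomain_at a.1)).trans ?_
  exact (congrArg Prod.fst (L.triv_hat (𝔸.mem_baseSet_at a.1))).symm

/-- The Legendre map is defined through one preferred trivialization; since `hat` does not depend on
any, the same formula holds in all adapted coordinates. -/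
theorem legendre_eq_point {i : 𝔸.ι} {x₀ : M} {a : 𝔸.red.Total} (ha : a.1 ∈ 𝔸.coordDomain i x₀) :
    L.legendre a = 𝔸.dual.red.point i x₀ ((𝔸.red.coords i x₀ a).1,
      (fderiv ℝ (L.localRep i x₀) (𝔸.red.coords i x₀ a)).comp
        (ContinuousLinearMap.inr ℝ E F)) := by
  have hx : (chartAt E x₀).symm (𝔸.red.coords i x₀ a).1 = a.1 := (chartAt E x₀).left_inv ha.1
  rw [L.legendre_eq_mk_hat]
  refine 𝔸.dual.red.total_ext hx.symm i ?_
  refine (congrArg Prod.fst (L.triv_hat ha.2)).trans ?_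
  have h1 := L.fderiv_localRep_inr (p := 𝔸.red.coords i x₀ a) (AffineBundle.chartAt_mem_coordTarget ha :
    (𝔸.red.coords i x₀ a).1 ∈ 𝔸.coordTarget i x₀)
  rw [hx] at h1
  exact h1.symm.trans (AffineEquiv.apply_symm_apply _ _).symm

end AVSection

end SpecialAffineBundle

end SpecialAffine

end

noncomputable section

namespace SpecialAffine

variable {E : Type*} [NormedAddCommGroup E] [NormedSpace ℝ E]
  {M : Type*} [TopologicalSpace M] [ChartedSpace E M]
  {F : Type*} [NormedAddCommGroup F] [NormedSpace ℝ F]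

/-! ### Tangent vectors in adapted coordinates -/

namespace AffineBundle

variable [IsManifold 𝓘(ℝ, E) ∞ M] (𝔹 : AffineBundle E M F)

/-- Chain rule applied to `point ∘ coords`, which is the identity near the base point. -/
theorem tangentMap_point_tangentCoords {i : 𝔹.ι} {x₀ : M}
    {w : TangentBundle (𝓘(ℝ, E).prod 𝓘(ℝ, F)) 𝔹.Total} (hw : w.proj.1 ∈ 𝔹.coordDomain i x₀) :
    tangentMap 𝓘(ℝ, E × F) (𝓘(ℝ, E).prod 𝓘(ℝ, F)) (𝔹.point i x₀)
      ⟨(𝔹.tangentCoords i x₀ w).1, (𝔹.tangentCoords i x₀ w).2⟩ = w := by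
  obtain ⟨a, v⟩ := w
  have h1 := (𝔹.contMDiffAt_coords hw).mdifferentiableAt (by simp)
  have h2 := (𝔹.contMDiffAt_point i x₀ (p := 𝔹.coords i x₀ a)
    (chartAt_mem_coordTarget hw)).mdifferentiableAt (by simp)
  have h3 : 𝔹.point i x₀ ∘ 𝔹.coords i x₀ =ᶠ[nhds a] id := by
    filter_upwards [𝔹.continuous_fst.continuousAt.preimage_mem_nhds
      ((𝔹.isOpen_coordDomain i x₀).mem_nhds hw)] with b hb using 𝔹.point_coords hb
  have h4 := mfderiv_comp a h2 h1
  rw [h3.mfderiv_eq, mfderiv_id] at h4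
  have h5 : v = mfderiv 𝓘(ℝ, E × F) (𝓘(ℝ, E).prod 𝓘(ℝ, F)) (𝔹.point i x₀) (𝔹.coords i x₀ a)
      (mfderiv (𝓘(ℝ, E).prod 𝓘(ℝ, F)) 𝓘(ℝ, E × F) (𝔹.coords i x₀) a v) :=
    congrArg (fun l => l v) h4
  have key : ∀ b : 𝔹.Total, b = a → ∀ u : E × F, v = u →
      (⟨b, u⟩ : TangentBundle (𝓘(ℝ, E).prod 𝓘(ℝ, F)) 𝔹.Total) = ⟨a, v⟩ := by
    rintro _ rfl _ rfl; rfl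
  exact key _ (𝔹.point_coords hw) _ h5

/-- A tangent vector is the image of its coordinates under the tangent map of `point`, which is
smooth. -/
theorem contMDiffAt_tangent_of_tangentCoords {G : Type*} [NormedAddCommGroup G] [NormedSpace ℝ G]
    {H N : Type*} [TopologicalSpace H] {I : ModelWithCorners ℝ G H} [TopologicalSpace N]
    [ChartedSpace H N] {i : 𝔹.ι} {x₀ : M}
    {w : N → TangentBundle (𝓘(ℝ, E).prod 𝓘(ℝ, F)) 𝔹.Total} {n : N}
    (hw : ∀ᶠ k in nhds n, (w k).proj.1 ∈ 𝔹.coordDomain i x₀)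
    (h : ContMDiffAt I 𝓘(ℝ, (E × F) × (E × F)) ∞ (fun k => 𝔹.tangentCoords i x₀ (w k)) n) :
    ContMDiffAt I (𝓘(ℝ, E).prod 𝓘(ℝ, F)).tangent ∞ w n := by
  have h1 : ContMDiffAt I 𝓘(ℝ, E × F).tangent ∞ (fun k =>
      (⟨(𝔹.tangentCoords i x₀ (w k)).1, (𝔹.tangentCoords i x₀ (w k)).2⟩ :
        TangentBundle 𝓘(ℝ, E × F) (E × F))) n := by
    refine Bundle.contMDiffAt_totalSpace.2 ⟨contDiff_fst.contMDiff.contMDiffAt.comp n h, ?_⟩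
    refine (contDiff_snd.contMDiff.contMDiffAt.comp n h).congr_of_eventuallyEq
      (Filter.Eventually.of_forall fun k => ?_)
    simp
  have ho : IsOpen (𝔹.coordTarget i x₀ ×ˢ (univ : Set F)) :=
    (𝔹.isOpen_coordTarget i x₀).prod isOpen_univ
  have h2 : ContMDiffOn 𝓘(ℝ, E × F) (𝓘(ℝ, E).prod 𝓘(ℝ, F)) ∞ (𝔹.point i x₀)
      (𝔹.coordTarget i x₀ ×ˢ (univ : Set F)) :=
    fun p hp => (𝔹.contMDiffAt_point i x₀ hp.1).contMDiffWithinAt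
  -- `point` is known to be smooth only over `coordTarget`; that set is open, so the derivative
  -- within it is the full one.
  have h3 := h2.contMDiffOn_tangentMapWithin (m := ∞) (by simp) ho.uniqueMDiffOn
  have hmem : (𝔹.tangentCoords i x₀ (w n)).1 ∈ 𝔹.coordTarget i x₀ ×ˢ (univ : Set F) :=
    ⟨chartAt_mem_coordTarget hw.self_of_nhds, mem_univ _⟩
  have h4 := h3.contMDiffAt (x := ⟨(𝔹.tangentCoords i x₀ (w n)).1,
    (𝔹.tangentCoords i x₀ (w n)).2⟩)
    ((FiberBundle.continuous_proj (E × F) _).continuousAt.preimage_mem_nhds (ho.mem_nhds hmem))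
  refine (ContMDiffAt.comp n h4 h1).congr_of_eventuallyEq ?_
  filter_upwards [hw] with k hk
  refine (𝔹.tangentMap_point_tangentCoords hk).symm.trans ?_
  change (⟨_, _⟩ : TangentBundle (𝓘(ℝ, E).prod 𝓘(ℝ, F)) 𝔹.Total) = ⟨_, _⟩
  rw [mfderivWithin_of_isOpen ho]
  exact ⟨chartAt_mem_coordTarget hk, mem_univ _⟩

end AffineBundle

/-! ### Sections and covectors of the bundle of affine values -/

namespace SpecialAffineBundle

variable {𝔸 : SpecialAffineBundle E M F}

theorem AVSection.exists_map_eq {g : 𝔸.red.Total → 𝔸.Total}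
    (hg : ContMDiff (𝓘(ℝ, E).prod 𝓘(ℝ, F)) (𝓘(ℝ, E).prod 𝓘(ℝ, F × ℝ)) ∞ g)
    (h : ∀ a, (⟨(g a).1, Red.mk (g a).2⟩ : 𝔸.red.Total) = a) :
    ∃ σ : 𝔸.AVSection, ∀ a, σ.map a = g a := by
  have h' : ∀ a : 𝔸.red.Total, ∃ v : 𝔸.Fib a.1, (⟨a.1, v⟩ : 𝔸.Total) = g a ∧
      (Red.mk v : Red (𝔸.Dir a.1) (𝔸.Fib a.1)) = a.2 := by
    intro a
    have ha := h a
    -- The base point of `g a` is only propositionally `a.1`; with `b` free, `a` can be eliminated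
    -- instead of casting between fibres.
    generalize g a = b at ha ⊢
    subst ha
    exact ⟨b.2, rfl, rfl⟩
  choose s hs hs' using h'
  refine ⟨⟨s, hs', ?_⟩, hs⟩
  exact hg.congr hs

variable [IsManifold 𝓘(ℝ, E) ∞ M]

/-- The differentials of two sections at a point agree if they have the same momenta. -/
theorem AVSection.d_eq_of_momenta_eq {σ τ : 𝔸.AVSection} {a : 𝔸.red.Total}
    (h : (σ.d a).momenta (𝔸.indexAt a.1) a.1 = (τ.d a).momenta (𝔸.indexAt a.1) a.1) :
    σ.d a = τ.d a := by
  -- Both sections lift the same class, so they differ by a multiple of the distinguished vector.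
  have h' : ∀ c : 𝔸.red.Total, ∃ r : ℝ,
      τ.toFun c = -r • (SpecialVectorSpace.vec : 𝔸.Dir c.1) +ᵥ σ.toFun c := by
    intro c
    have hc := Red.mk_eq_mk.1 ((τ.mk_toFun c).trans (σ.mk_toFun c).symm)
    obtain ⟨r, hr⟩ := Submodule.mem_span_singleton.1 hc
    exact ⟨-r, by rw [neg_neg, hr, vsub_vadd]⟩
  choose f hf using h'
  -- The sign in `-r • vec` and the one in `fiberRep` cancel, so `f` is `τ - σ` in every
  -- trivialization. Hence `f` is smooth, and its differential is the difference of the momenta.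
  have hfi : ∀ (i : 𝔸.ι) (c : 𝔸.red.Total),
      f c = τ.fiberRep i c.1 (𝔸.red.triv i c.1 c.2) - σ.fiberRep i c.1 (𝔸.red.triv i c.1 c.2) := by
    intro i c
    have h1 := congrArg (fun v => (𝔸.triv i c.1 v).2) (hf c)
    simp only [AffineEquiv.map_vadd, map_smul, 𝔸.triv_vec, AVSection.triv_toFun] at h1
    simp at h1
    linarith
  have hloc : ∀ (i : 𝔸.ι) (x₀ : M) (c : 𝔸.red.Total), c.1 ∈ 𝔸.coordDomain i x₀ →
      f =ᶠ[nhds c] fun b => τ.localRep i x₀ (𝔸.red.coords i x₀ b) -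
        σ.localRep i x₀ (𝔸.red.coords i x₀ b) := by
    intro i x₀ c hc
    filter_upwards [𝔸.red.continuous_fst.continuousAt.preimage_mem_nhds
      ((𝔸.isOpen_coordDomain i x₀).mem_nhds hc)] with b hb
    rw [localRep_apply, localRep_apply, show (chartAt E x₀).symm (𝔸.red.coords i x₀ b).1 = b.1 from
      (chartAt E x₀).left_inv hb.1]
    exact hfi i b
  refine Quotient.sound (s := 𝔸.phaseSetoid) ⟨rfl, f, fun c => ?_, hf, ?_⟩
  · have hc := 𝔸.mem_coordDomain_at c.1
    have ht : (𝔸.red.coords (𝔸.indexAt c.1) c.1 c).1 ∈ 𝔸.coordTarget (𝔸.indexAt c.1) c.1 :=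
      AffineBundle.chartAt_mem_coordTarget hc
    have h1 := (τ.contDiffAt_localRep ht).sub (σ.contDiffAt_localRep ht)
    have h2 : ContMDiffAt (𝓘(ℝ, E).prod 𝓘(ℝ, F)) 𝓘(ℝ, E × F) ∞
      (𝔸.red.coords (𝔸.indexAt c.1) c.1) c := 𝔸.red.contMDiffAt_coords hc
    exact (h1.contMDiffAt.comp c h2).congr_of_eventuallyEq (hloc _ _ c hc)
  · have ha := 𝔸.mem_coordDomain_at a.1
    have ht : (𝔸.red.coords (𝔸.indexAt a.1) a.1 a).1 ∈ 𝔸.coordTarget (𝔸.indexAt a.1) a.1 :=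
      AffineBundle.chartAt_mem_coordTarget ha
    rw [σ.momenta_d ha, τ.momenta_d ha] at h
    have h0 : fderiv ℝ (σ.localRep (𝔸.indexAt a.1) a.1) (𝔸.red.coords (𝔸.indexAt a.1) a.1 a) =
        fderiv ℝ (τ.localRep (𝔸.indexAt a.1) a.1) (𝔸.red.coords (𝔸.indexAt a.1) a.1 a) :=
      ContinuousLinearMap.prod_ext (congrArg Prod.fst h) (congrArg Prod.snd h)
    have h1 := (τ.differentiableAt_localRep ht).hasFDerivAt.sub
      (σ.differentiableAt_localRep ht).hasFDerivAt
    rw [h0, sub_self] at h1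
    have h2 : ContMDiffAt (𝓘(ℝ, E).prod 𝓘(ℝ, F)) 𝓘(ℝ, E × F) ∞
      (𝔸.red.coords (𝔸.indexAt a.1) a.1) a := 𝔸.red.contMDiffAt_coords ha
    have h3 := h1.hasMFDerivAt.comp a (h2.mdifferentiableAt (by simp)).hasMFDerivAt
    exact (h3.congr_of_eventuallyEq (hloc _ _ a ha)).mfderiv.trans
      (ContinuousLinearMap.zero_comp _)

variable [FiniteDimensional ℝ F]

/-- The canonical isomorphism of phase bundles is injective. -/
theorem PhaseIso.left_unique {p p' : 𝔸.Phase} {q : 𝔸.dual.Phase} (h : PhaseIso p q)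
    (h' : PhaseIso p' q) : p = p' := by
  induction p using Quotient.ind with | _ r =>
  induction p' using Quotient.ind with | _ r' =>
  obtain ⟨a, σ⟩ := r
  obtain ⟨a', σ'⟩ := r'
  change PhaseIso (σ.d a) q at h
  change PhaseIso (σ'.d a') q at h'
  change σ.d a = σ'.d a'
  have hb : (σ.d a).dualBase = (σ'.d a').dualBase := h.1.symm.trans h'.1
  have hx : a.1 = a'.1 := congrArg (fun b : 𝔸.dual.red.Total => b.1) hb
  have ha : a.1 ∈ 𝔸.coordDomain (𝔸.indexAt a.1) a.1 := 𝔸.mem_coordDomain_at a.1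
  have ha' : a'.1 ∈ 𝔸.coordDomain (𝔸.indexAt a.1) a.1 := by rw [← hx]; exact ha
  have hm := (h.2 _ _ ha).symm.trans (h'.2 _ _ ha')
  have h1 := neg_injective (congrArg Prod.fst hm)
  -- The momenta of `q` record `y` as evaluation at `y`, and functionals separate the points of `F`.
  have h2 : (𝔸.red.coords (𝔸.indexAt a.1) a.1 a).2 = (𝔸.red.coords (𝔸.indexAt a.1) a.1 a').2 :=
    SeparatingDual.eq_iff_forall_dual_eq (R := ℝ).2 fun g =>
      congrArg (fun l : (F →L[ℝ] ℝ) →L[ℝ] ℝ => l g) (congrArg Prod.snd hm)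
  obtain rfl : a = a' := 𝔸.red.total_ext hx (𝔸.indexAt a.1) h2
  -- The component `p` is recovered from the momenta of `q`, the component `π` from its base point.
  refine AVSection.d_eq_of_momenta_eq (Prod.ext h1 ?_)
  exact (𝔸.dual.red.triv (𝔸.indexAt a.1) a.1).symm.injective
    (TotalSpace.mk_inj.1 hb)

end SpecialAffineBundle

end SpecialAffine

end

noncomputable section

namespace SpecialAffine

variable {E : Type*} [NormedAddCommGroup E] [NormedSpace ℝ E]
  {M : Type*} [TopologicalSpace M] [ChartedSpace E M] [IsManifold 𝓘(ℝ, E) ∞ M]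
  {F : Type*} [NormedAddCommGroup F] [NormedSpace ℝ F] [FiniteDimensional ℝ F]

/-! ### The affine Legendre transform in adapted coordinates -/

namespace SpecialAffineBundle

variable {𝔸 : SpecialAffineBundle E M F}

namespace AVSection

variable {L : 𝔸.AVSection}
  {leg : 𝔸.red.Total ≃ₘ^∞⟮𝓘(ℝ, E).prod 𝓘(ℝ, F), 𝓘(ℝ, E).prod 𝓘(ℝ, F →L[ℝ] ℝ)⟯
    𝔸.dual.red.Total}

/-- The Hamiltonian section defined by a hyperregular Lagrangian section. -/
theorem exists_map_eq_hat (hleg : ∀ a, leg a = L.legendre a) :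
    ∃ H : 𝔸.dual.AVSection, ∀ α, H.map α = L.hat (leg.symm α) := by
  refine AVSection.exists_map_eq (g := fun α => L.hat (leg.symm α))
    (L.contMDiff_hat.comp leg.symm.contMDiff) fun α => ?_
  refine (L.legendre_eq_mk_hat (leg.symm α)).symm.trans ?_
  rw [← hleg, leg.apply_symm_apply]

variable {H : 𝔸.dual.AVSection}

/-- The coordinate `ξ₀` is `-c`, and `hat` has `c = ℓ - y ∂ℓ/∂y`. -/
theorem localRep_of_map_eq_hat (hleg : ∀ a, leg a = L.legendre a)
    (hH : ∀ α, H.map α = L.hat (leg.symm α)) {i : 𝔸.ι} {x₀ : M} {a : 𝔸.red.Total}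
    (ha : a.1 ∈ 𝔸.coordDomain i x₀) :
    H.localRep i x₀ ((𝔸.red.coords i x₀ a).1,
      (fderiv ℝ (L.localRep i x₀) (𝔸.red.coords i x₀ a)).comp (ContinuousLinearMap.inr ℝ E F)) =
      fderiv ℝ (L.localRep i x₀) (𝔸.red.coords i x₀ a) (0, (𝔸.red.coords i x₀ a).2) -
        L.localRep i x₀ (𝔸.red.coords i x₀ a) := by
  have h1 := hH (leg a)
  rw [leg.symm_apply_apply, L.hat_eq_point ha] at h1
  have h2 : leg a = _ := (hleg a).trans (L.legendre_eq_point ha)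
  rw [h2] at h1
  have ht : (𝔸.red.coords i x₀ a).1 ∈ 𝔸.coordTarget i x₀ :=
    AffineBundle.chartAt_mem_coordTarget ha
  have h3 := congrArg (fun b => -(𝔸.dual.coords i x₀ b).2.2) h1
  refine h3.trans ?_
  have h4 := 𝔸.dual.coords_point (i := i) (x₀ := x₀) (p := ((𝔸.red.coords i x₀ a).1,
      ((fderiv ℝ (L.localRep i x₀) (𝔸.red.coords i x₀ a)).comp (ContinuousLinearMap.inr ℝ E F),
        L.localRep i x₀ (𝔸.red.coords i x₀ a) -
          fderiv ℝ (L.localRep i x₀) (𝔸.red.coords i x₀ a) (0, (𝔸.red.coords i x₀ a).2)))) ht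
  refine (congrArg (fun q : E × (F →L[ℝ] ℝ) × ℝ => -q.2.2) h4).trans ?_
  exact neg_sub _ _

/-- The derivative of the Hamiltonian: `∂H/∂x = -∂L/∂x` and `∂H/∂ξ = y`. -/
theorem hasFDerivAt_localRep_of_map_eq_hat (hleg : ∀ a, leg a = L.legendre a)
    (hH : ∀ α, H.map α = L.hat (leg.symm α)) {i : 𝔸.ι} {x₀ : M} {a : 𝔸.red.Total}
    (ha : a.1 ∈ 𝔸.coordDomain i x₀) :
    HasFDerivAt (H.localRep i x₀)
      ((-(fderiv ℝ (L.localRep i x₀) (𝔸.red.coords i x₀ a)).comp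
        (ContinuousLinearMap.inl ℝ E F)).coprod
          (ContinuousLinearMap.apply ℝ ℝ (𝔸.red.coords i x₀ a).2))
      ((𝔸.red.coords i x₀ a).1,
        (fderiv ℝ (L.localRep i x₀) (𝔸.red.coords i x₀ a)).comp
          (ContinuousLinearMap.inr ℝ E F)) := by
  set ℓ := L.localRep i x₀
  set p := 𝔸.red.coords i x₀ a with hp
  set q₀ : E × (F →L[ℝ] ℝ) := (p.1, (fderiv ℝ ℓ p).comp (ContinuousLinearMap.inr ℝ E F))
    with hq₀
  have ht : p.1 ∈ 𝔸.coordTarget i x₀ := AffineBundle.chartAt_mem_coordTarget ha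
  have hlegp : leg a = 𝔸.dual.red.point i x₀ q₀ := (hleg a).trans (L.legendre_eq_point ha)
  -- The inverse Legendre map in adapted coordinates.
  let K : E × (F →L[ℝ] ℝ) → E × F :=
    fun q => 𝔸.red.coords i x₀ (leg.symm (𝔸.dual.red.point i x₀ q))
  have hK0 : K q₀ = p := by
    change 𝔸.red.coords i x₀ (leg.symm (𝔸.dual.red.point i x₀ q₀)) = p
    rw [← hlegp, leg.symm_apply_apply]
  have hproj : ∀ α, (leg.symm α).1 = α.1 := fun α =>
    congrArg (fun b : 𝔸.dual.red.Total => b.1)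
      ((hleg (leg.symm α)).symm.trans (leg.apply_symm_apply α))
  have hdom : ∀ q : E × (F →L[ℝ] ℝ), q.1 ∈ 𝔸.coordTarget i x₀ →
      (leg.symm (𝔸.dual.red.point i x₀ q)).1 ∈ 𝔸.coordDomain i x₀ := fun q hq => by
    rw [hproj]; exact AffineBundle.chartAt_symm_mem_coordDomain hq
  have hK : ∀ q : E × (F →L[ℝ] ℝ), q.1 ∈ 𝔸.coordTarget i x₀ →
      ((K q).1, (fderiv ℝ ℓ (K q)).comp (ContinuousLinearMap.inr ℝ E F)) = q := by
    intro q hq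
    have h1 := (hleg (leg.symm (𝔸.dual.red.point i x₀ q))).symm.trans (leg.apply_symm_apply _)
    rw [L.legendre_eq_point (hdom q hq)] at h1
    have h2 := congrArg (𝔸.dual.red.coords i x₀) h1
    have h3 := 𝔸.dual.red.coords_point (i := i) (x₀ := x₀) (p := q) hq
    have h4 := 𝔸.dual.red.coords_point (i := i) (x₀ := x₀)
      (p := ((K q).1, (fderiv ℝ ℓ (K q)).comp (ContinuousLinearMap.inr ℝ E F)))
      (AffineBundle.chartAt_mem_coordTarget (hdom q hq))
    exact h4.symm.trans (h2.trans h3)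
  -- The formula for `H` as a function of the free variable `q = (x, ξ)`, so that it can be
  -- differentiated.
  have hHK : ∀ q : E × (F →L[ℝ] ℝ), q.1 ∈ 𝔸.coordTarget i x₀ →
      H.localRep i x₀ q = q.2 (K q).2 - ℓ (K q) := by
    intro q hq
    have h1 := localRep_of_map_eq_hat hleg hH (hdom q hq)
    change H.localRep i x₀ ((K q).1, (fderiv ℝ ℓ (K q)).comp (ContinuousLinearMap.inr ℝ E F)) =
      (fderiv ℝ ℓ (K q)).comp (ContinuousLinearMap.inr ℝ E F) (K q).2 - ℓ (K q) at h1
    have h2 := congrArg Prod.snd (hK q hq)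
    change (fderiv ℝ ℓ (K q)).comp (ContinuousLinearMap.inr ℝ E F) = q.2 at h2
    rwa [hK q hq, h2] at h1
  have hnear : ∀ᶠ q : E × (F →L[ℝ] ℝ) in nhds q₀, q.1 ∈ 𝔸.coordTarget i x₀ :=
    continuous_fst.continuousAt.preimage_mem_nhds ((𝔸.isOpen_coordTarget i x₀).mem_nhds ht)
  have hKd : DifferentiableAt ℝ K q₀ := by
    have h1 : ContMDiffAt 𝓘(ℝ, E × (F →L[ℝ] ℝ)) (𝓘(ℝ, E).prod 𝓘(ℝ, F →L[ℝ] ℝ)) ∞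
        (𝔸.dual.red.point i x₀) q₀ := 𝔸.dual.red.contMDiffAt_point i x₀ ht
    have h2 := ContMDiffAt.comp q₀ (leg.symm.contMDiff (𝔸.dual.red.point i x₀ q₀)) h1
    have h3 : ContMDiffAt (𝓘(ℝ, E).prod 𝓘(ℝ, F)) 𝓘(ℝ, E × F) ∞ (𝔸.red.coords i x₀)
        (leg.symm (𝔸.dual.red.point i x₀ q₀)) := 𝔸.red.contMDiffAt_coords (hdom q₀ ht)
    exact (ContMDiffAt.comp (g := 𝔸.red.coords i x₀)
      (f := fun q => leg.symm (𝔸.dual.red.point i x₀ q)) q₀ h3 h2).contDiffAt.differentiableAt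
        (by simp)
  have hKf := hKd.hasFDerivAt
  -- `K` preserves `x`, so only the `y`-component of its derivative is unknown.
  have hfst : (ContinuousLinearMap.fst ℝ E F).comp (fderiv ℝ K q₀) =
      ContinuousLinearMap.fst ℝ E (F →L[ℝ] ℝ) := by
    refine HasFDerivAt.unique hKf.fst (hasFDerivAt_fst.congr_of_eventuallyEq ?_)
    filter_upwards [hnear] with q hq using congrArg Prod.fst (hK q hq)
  have hℓ : HasFDerivAt ℓ (fderiv ℝ ℓ p) (K q₀) := by
    rw [hK0]; exact (L.differentiableAt_localRep ht).hasFDerivAt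
  have hmain := ((hasFDerivAt_snd (𝕜 := ℝ) (p := q₀)).clm_apply hKf.snd).sub (hℓ.comp q₀ hKf)
  refine (hmain.congr_of_eventuallyEq ?_).congr_fderiv ?_
  · filter_upwards [hnear] with q hq using hHK q hq
  -- The unknown component enters through `ξ dy` and `-(∂ℓ/∂y) dy`; these cancel because `ξ = ∂ℓ/∂y`
  -- at `p`.
  · refine ContinuousLinearMap.ext fun ⟨dx, η⟩ => ?_
    have e1 : (fderiv ℝ K q₀ (dx, η)).1 = dx :=
      congrArg (fun l : E × (F →L[ℝ] ℝ) →L[ℝ] E => l (dx, η)) hfst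
    have e2 : fderiv ℝ ℓ p (fderiv ℝ K q₀ (dx, η)) =
        fderiv ℝ ℓ p (dx, 0) + fderiv ℝ ℓ p (0, (fderiv ℝ K q₀ (dx, η)).2) := by
      rw [← map_add]
      congr 1
      exact Prod.ext (by simp [e1]) (by simp)
    simp [hK0, e2, q₀]
    ring

/-- The equations `∂H/∂x = -∂ℓ/∂x` and `∂H/∂ξ = y` are the coordinate form `(x, y, p, π) ↦ (x, π,
-p, y)` of the canonical isomorphism. -/
theorem phaseIso_of_map_eq_hat (hleg : ∀ a, leg a = L.legendre a)
    (hH : ∀ α, H.map α = L.hat (leg.symm α)) (a : 𝔸.red.Total) :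
    PhaseIso (L.d a) (H.d (leg a)) := by
  refine ⟨hleg a, fun i x₀ ha => ?_⟩
  replace ha : a.1 ∈ 𝔸.coordDomain i x₀ := ha
  have hd := (hasFDerivAt_localRep_of_map_eq_hat hleg hH ha).fderiv
  have hlegp : leg a = _ := (hleg a).trans (L.legendre_eq_point ha)
  have hmem : (leg a).1 ∈ 𝔸.dual.coordDomain i x₀ := by
    rw [hleg a]; exact ha
  have hc : 𝔸.dual.red.coords i x₀ (leg a) = ((𝔸.red.coords i x₀ a).1,
        (fderiv ℝ (L.localRep i x₀) (𝔸.red.coords i x₀ a)).comp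
          (ContinuousLinearMap.inr ℝ E F)) := by
    rw [hlegp]
    exact 𝔸.dual.red.coords_point (i := i) (p := (_, _)) (AffineBundle.chartAt_mem_coordTarget ha)
  rw [L.momenta_d ha]
  refine (H.momenta_d hmem).trans ?_
  refine Prod.ext ?_ ?_
  · change (fderiv ℝ (H.localRep i x₀) (𝔸.dual.red.coords i x₀ (leg a))).comp _ = -_
    rw [hc, hd]
    exact ContinuousLinearMap.coprod_comp_inl _ _
  · change (fderiv ℝ (H.localRep i x₀) (𝔸.dual.red.coords i x₀ (leg a))).comp _ = _
    rw [hc, hd]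
    exact ContinuousLinearMap.coprod_comp_inr _ _

end AVSection

end SpecialAffineBundle

/-! ### The Hamiltonian vector field -/

namespace SpecialAffgebroid

variable {𝔸 : SpecialAffineBundle E M F} (ℰ : SpecialAffgebroid 𝔸)

/-- Injectivity of the canonical isomorphism makes the chosen preimage equal to any given one. -/
theorem tensorMap_eq {p : 𝔸.Phase} {q : 𝔸.dual.Phase} (h : PhaseIso p q) :
    ℰ.tensorMap q = ℰ.toFun p := by
  have hq : ∃ p : 𝔸.Phase, PhaseIso p q := ⟨p, h⟩
  rw [tensorMap, dif_pos hq, hq.choose_spec.left_unique h]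

/-- The momenta of `L.d` are first derivatives of a smooth function, and they are substituted into
the smooth maps `Φ₁` and `Φ₃`. -/
theorem contMDiff_toFun_d (L : 𝔸.AVSection) :
    ContMDiff (𝓘(ℝ, E).prod 𝓘(ℝ, F)) (𝓘(ℝ, E).prod 𝓘(ℝ, F →L[ℝ] ℝ)).tangent ∞
      (fun a => ℰ.toFun (L.d a)) := by
  intro a
  have ha := 𝔸.mem_coordDomain_at a.1
  set i := 𝔸.indexAt a.1
  set x₀ := a.1
  obtain ⟨Φ₁, Φ₃, hΦ, hE⟩ := ℰ.isMorphism i x₀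
  have ht : (𝔸.red.coords i x₀ a).1 ∈ 𝔸.coordTarget i x₀ :=
    AffineBundle.chartAt_mem_coordTarget ha
  have hnear : ∀ᶠ b : 𝔸.red.Total in nhds a, b.1 ∈ 𝔸.coordDomain i x₀ :=
    𝔸.red.continuous_fst.continuousAt.preimage_mem_nhds ((𝔸.isOpen_coordDomain i x₀).mem_nhds ha)
  have hT := (𝔸.isOpen_coordTarget i x₀).mem_nhds ht
  refine AffineBundle.contMDiffAt_tangent_of_tangentCoords 𝔸.dual.red (i := i) (x₀ := x₀) ?_ ?_
  · filter_upwards [hnear] with b hb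
    rw [ℰ.proj_toFun]
    exact hb
  have h1 := L.contDiffAt_localRep ht
  have h2 : ContDiffAt ℝ ∞ (fderiv ℝ (L.localRep i x₀)) (𝔸.red.coords i x₀ a) :=
    h1.fderiv_right (by simp)
  have hp := h2.clm_comp (contDiffAt_const (c := ContinuousLinearMap.inl ℝ E F))
  have hπ := h2.clm_comp (contDiffAt_const (c := ContinuousLinearMap.inr ℝ E F))
  have h3 : ContDiffAt ℝ ∞ (fun r : E × F => Φ₁ r.1 r.2) (𝔸.red.coords i x₀ a) :=
    hΦ.contDiffOn₁.contDiffAt (prod_mem_nhds hT Filter.univ_mem)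
  have h4 : ContDiffAt ℝ ∞ (fun r : E × F => Φ₃ r.1 r.2
      ((fderiv ℝ (L.localRep i x₀) r).comp (ContinuousLinearMap.inr ℝ E F))
      ((fderiv ℝ (L.localRep i x₀) r).comp (ContinuousLinearMap.inl ℝ E F)))
      (𝔸.red.coords i x₀ a) := by
    refine ContDiffAt.comp (𝔸.red.coords i x₀ a)
      (g := fun p : E × F × (F →L[ℝ] ℝ) × (E →L[ℝ] ℝ) => Φ₃ p.1 p.2.1 p.2.2.1 p.2.2.2)
      (f := fun r : E × F => (r.1, r.2,
        (fderiv ℝ (L.localRep i x₀) r).comp (ContinuousLinearMap.inr ℝ E F),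
        (fderiv ℝ (L.localRep i x₀) r).comp (ContinuousLinearMap.inl ℝ E F)))
      (hΦ.contDiffOn₃.contDiffAt (prod_mem_nhds hT Filter.univ_mem))
      (contDiffAt_fst.prodMk (contDiffAt_snd.prodMk (hπ.prodMk hp)))
  have h5 := (contDiffAt_fst.prodMk hπ).prodMk (h3.prodMk h4)
  have h6 : ContMDiffAt (𝓘(ℝ, E).prod 𝓘(ℝ, F)) 𝓘(ℝ, E × F) ∞ (𝔸.red.coords i x₀) a :=
    𝔸.red.contMDiffAt_coords ha
  refine (h5.contMDiffAt.comp a h6).congr_of_eventuallyEq ?_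
  filter_upwards [hnear] with b hb
  have h7 := hE (L.d b) hb
  rw [L.momenta_d hb] at h7
  exact h7

/-- The vector field is the dynamics reparametrized by the inverse Legendre map; the bracket sees
the same vector, since `L.d (leg.symm φ)` corresponds to `H.d φ`. -/
theorem isHamiltonian_of_map_eq_hat {L : 𝔸.AVSection}
    {leg : 𝔸.red.Total ≃ₘ^∞⟮𝓘(ℝ, E).prod 𝓘(ℝ, F), 𝓘(ℝ, E).prod 𝓘(ℝ, F →L[ℝ] ℝ)⟯
      𝔸.dual.red.Total} (hleg : ∀ a, leg a = L.legendre a) {H : 𝔸.dual.AVSection}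
    (hH : ∀ α, H.map α = L.hat (leg.symm α)) : ℰ.IsHamiltonian L H := by
  have hX : ∀ φ : 𝔸.dual.red.Total,
      ∃ v : TangentSpace (𝓘(ℝ, E).prod 𝓘(ℝ, F →L[ℝ] ℝ)) φ,
        (⟨φ, v⟩ : 𝔸.DualTangent) = ℰ.toFun (L.d (leg.symm φ)) := by
    intro φ
    have h : (ℰ.toFun (L.d (leg.symm φ))).proj = φ := by
      rw [ℰ.proj_toFun]
      exact (hleg (leg.symm φ)).symm.trans (leg.apply_symm_apply φ)
    generalize ℰ.toFun (L.d (leg.symm φ)) = w at h ⊢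
    subst h
    exact ⟨w.2, rfl⟩
  choose X hX using hX
  refine ⟨X, ⟨?_, fun f _ φ => ?_⟩, ?_⟩
  · exact ((ℰ.contMDiff_toFun_d L).comp leg.symm.contMDiff).congr hX
  · have h1 := AVSection.phaseIso_of_map_eq_hat hleg hH (leg.symm φ)
    rw [leg.apply_symm_apply] at h1
    rw [bracket, ℰ.tensorMap_eq h1, ← hX]
  · rw [dynamics, ← range_comp]
    -- Surjectivity of `leg.symm` ensures that no point of the dynamics is lost.
    refine Eq.trans ?_ (leg.symm.surjective.range_comp fun a => ℰ.toFun (L.d a))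
    exact congrArg range (funext hX)

end SpecialAffgebroid

end SpecialAffine

end

/-! ### The affine Legendre transformation of a hyperregular Lagrangian section -/

theorem mainTheorem1
    {E : Type*} [NormedAddCommGroup E] [NormedSpace ℝ E] [FiniteDimensional ℝ E]
    {M : Type*} [TopologicalSpace M] [ChartedSpace E M] [IsManifold 𝓘(ℝ, E) ∞ M]
    [T2Space M] [SigmaCompactSpace M]
    {F : Type*} [NormedAddCommGroup F] [NormedSpace ℝ F] [FiniteDimensional ℝ F]
    (𝔸 : SpecialAffineBundle E M F) (ℰ : SpecialAffgebroid 𝔸) (L : 𝔸.AVSection)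
    (leg : 𝔸.red.Total ≃ₘ^∞⟮𝓘(ℝ, E).prod 𝓘(ℝ, F), 𝓘(ℝ, E).prod 𝓘(ℝ, F →L[ℝ] ℝ)⟯
      𝔸.dual.red.Total)
    (hleg : ∀ a, leg a = L.legendre a) :
    (∀ a : 𝔸.red.Total, ∃! φ, L.VanishesOnTangent a φ) ∧
    ∃ H : 𝔸.dual.AVSection,
      (∀ α, H.map α = L.hat (leg.symm α)) ∧
      ℰ.IsHamiltonian L H ∧
      ∀ (i : 𝔸.ι) (x₀ : M), ∀ x ∈ 𝔸.coordTarget i x₀, ∀ y : F,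
        leg (𝔸.red.point i x₀ (x, y)) =
          𝔸.dual.red.point i x₀ (x, fderiv ℝ (fun y' => L.localRep i x₀ (x, y')) y) ∧
        H.localRep i x₀ (x, fderiv ℝ (fun y' => L.localRep i x₀ (x, y')) y) =
          fderiv ℝ (fun y' => L.localRep i x₀ (x, y')) y y - L.localRep i x₀ (x, y) := by
  refine ⟨L.existsUnique_vanishesOnTangent, ?_⟩
  obtain ⟨H, hH⟩ := AVSection.exists_map_eq_hat hleg
  refine ⟨H, hH, ℰ.isHamiltonian_of_map_eq_hat hleg hH, fun i x₀ x hx y => ?_⟩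
  have hc : 𝔸.red.coords i x₀ (𝔸.red.point i x₀ (x, y)) = (x, y) :=
    𝔸.red.coords_point (i := i) (p := (x, y)) hx
  have ha : (𝔸.red.point i x₀ (x, y)).1 ∈ 𝔸.coordDomain i x₀ :=
    AffineBundle.chartAt_symm_mem_coordDomain hx
  have hd : fderiv ℝ (fun y' => L.localRep i x₀ (x, y')) y =
      (fderiv ℝ (L.localRep i x₀) (x, y)).comp (ContinuousLinearMap.inr ℝ E F) :=
    (L.fderiv_localRep_inr (p := (x, y)) hx).symm
  rw [hd]
  have h1 := L.legendre_eq_point ha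
  have h2 := AVSection.localRep_of_map_eq_hat hleg hH ha
  rw [hc] at h1 h2
  exact ⟨(hleg _).trans h1, h2⟩
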